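/- **Theorem 3.1.** Let $d\ge 2$ and $0<T<\infty$. Assume: * $\beta\in C^1(\mathbb R)$, $\beta(0)=0$ and $\beta'(r)>0$ for all $r\in\mathbb R$; * $D\in L^\infty(\mathbb R^d;\mathbb R^d)$; * $b\in C^1(\mathbb R)$; * $\Psi:[0,\infty)\to[0,\infty)$ is a Bernstein function of the form $\Psi(r)=\int_{(0,\infty)}(1-e^{-rt})\,\mu(dt)$, $r\ge 0$, where $\mu$ is a positive measure on $(0,\infty)$ with $\int_{(0,\infty)}(1\wedge t)\,\mu(dt)<\infty$, and there are $s\in(\tfrac12,1)$ and $C\in(0,\infty)$ with $\Psi(r)\ge C r^s$ for all $r\ge 0$. For $f\in C_0^\infty(\mathbb R^d)$ let $\Psi(-\Delta)f$ be defined by $\mathcal F(\Psi(-\Delta)f)(\xi)=\Psi(|\xi|^2)\,\mathcal F(f)(\xi)$, where $\mathcal F(f)(\xi)=(2\pi)^{-d/2}\int_{\mathbb R^d}e^{ix\cdot\xi}f(x)\,dx$. A function $u\in L^\infty((0,T)\times\mathbb R^d)$ is called a distributional solution on $(0,T)\times\mathbb R^d$ of $$u_t+\Psi(-\Delta)(\beta(u))+\operatorname{div}(D\,b(u)\,u)=0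 \tag{1.1}$$ if $$\int_0^T\!\!\int_{\mathbb R^d}\Big(u(t,x)\,\varphi_t(t,x)-\Psi(-\Delta)(\varphi(t,\cdot))(x)\,\beta(u(t,x))+b(u(t,x))\,u(t,x)\,D(x)\cdot\nabla\varphi(t,x)\Big)\,dx\,dt=0$$ for all $\varphi\in C_0^\infty((0,T)\times\mathbb R^d)$, where $\nabla$ acts in $x$. Let $y_1,y_2\in L^\infty((0,T)\times\mathbb R^d)$ be two distributional solutions of (1.1) on $(0,T)\times\mathbb R^d$ such that $y_1-y_2\in L^1((0,T)\times\mathbb R^d)\cap L^\infty(0,T;L^2(\mathbb R^d))$ and $$\lim_{t\to0+}\ \operatorname*{ess\,sup}_{s\in(0,t)}\Big|\int_{\mathbb R^d}(y_1(s,x)-y_2(s,x))\,\varphi(x)\,dx\Big|=0\qquad\text{for all }\varphi\in C_0^\infty(\mathbb R^d). \tag{3.1}$$ Then $y_1=y_2$ almost everywhere on $(0,T)\times\mathbb R^d$. If $D=0$ almost everywhere, the same conclusion holds with the condition $\beta'(r)>0$ for all $r$ relaxed to $\beta'(r)\ge 0$ for all $r$. -/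

import Mathlib

open MeasureTheory Set Filter Topology
open scoped ContDiff FourierTransform Gradient

namespace NonlocalFPE

/-- The Euclidean space `ℝ^d`. -/
abbrev E (d : ℕ) : Type := EuclideanSpace ℝ (Fin d)

/-- Lebesgue measure on the cylinder `(0,T) × ℝ^d`. -/
noncomputable abbrev cyl (d : ℕ) (T : ℝ) : Measure (ℝ × E d) :=
  (volume.restrict (Ioo (0 : ℝ) T)).prod (volume : Measure (E d))

/-- `Ψ` (only its values on `[0,∞)` matter) is a Bernstein function without killing and drift
terms: `Ψ(r) = ∫_{(0,∞)} (1 - e^{-rt}) μ(dt)` for a positive measure `μ` on `(0,∞)` with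
`∫_{(0,∞)} (1 ∧ t) μ(dt) < ∞`. -/
def IsPureJumpBernstein (Ψ : ℝ → ℝ) : Prop :=
  ∃ μ : Measure ℝ,
    (∫⁻ t in Ioi (0 : ℝ), ENNReal.ofReal (min 1 t) ∂μ) < ⊤ ∧
    ∀ r : ℝ, 0 ≤ r → Ψ r = ∫ t in Ioi (0 : ℝ), (1 - Real.exp (-(r * t))) ∂μ

/-- The lower bound `Ψ(r) ≥ C r^s` on `[0,∞)` for some `s ∈ (1/2, 1)` and some `C ∈ (0,∞)`. -/
def HasPowerLowerBound (Ψ : ℝ → ℝ) : Prop :=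
  ∃ s : ℝ, 1 / 2 < s ∧ s < 1 ∧ ∃ C : ℝ, 0 < C ∧ ∀ r : ℝ, 0 ≤ r → C * r ^ s ≤ Ψ r

/-- The operator `Ψ(-Δ)` on real test functions, as the Fourier multiplier with symbol
`Ψ(|ξ|²)` for the Fourier transform with kernel `e^{± i x·ξ}`. Mathlib's Fourier transform has the
kernel `e^{-2π i x·ξ}`, so in its frequency variable the symbol reads `Ψ(|2πξ|²)`. The inverse
transform is real-valued here, because the symbol is real and even. -/
noncomputable def psiNegLaplacian {d : ℕ} (Ψ : ℝ → ℝ) (f : E d → ℝ) (x : E d) : ℝ :=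
  (𝓕⁻ (fun ξ : E d =>
    ((Ψ ((2 * Real.pi * ‖ξ‖) ^ 2) : ℝ) : ℂ) * 𝓕 (fun y : E d => ((f y : ℝ) : ℂ)) ξ) x).re

/-- `u` is a distributional solution on `(0,T) × ℝ^d` of
`u_t + Ψ(-Δ)(β(u)) + div(D b(u) u) = 0`: the weak formulation holds for all
`φ ∈ C_0^∞((0,T) × ℝ^d)`. No initial datum is prescribed: a function that satisfies the weak
formulation with test functions in `C_0^∞([0,T) × ℝ^d)` and the additional term
`∫ φ(0,x) u₀(dx)`, for any initial measure `u₀`, is a solution in the present sense. -/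
def IsDistributionalSolution {d : ℕ} (T : ℝ) (Ψ β b : ℝ → ℝ) (D : E d → E d)
    (u : ℝ × E d → ℝ) : Prop :=
  ∀ φ : ℝ × E d → ℝ, ContDiff ℝ ∞ φ → HasCompactSupport φ →
    tsupport φ ⊆ Ioo (0 : ℝ) T ×ˢ (univ : Set (E d)) →
    ∫ p : ℝ × E d,
      (u p * deriv (fun τ : ℝ => φ (τ, p.2)) p.1
        - psiNegLaplacian Ψ (fun y : E d => φ (p.1, y)) p.2 * β (u p)
        + b (u p) * u p * inner ℝ (D p.2) (∇ (fun y : E d => φ (p.1, y)) p.2)) ∂(cyl d T) = 0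

/-- `z ∈ L^∞(0,T; L²(ℝ^d))`, for a function `z` given on `(0,T) × ℝ^d`. -/
def MemLInftyL2 {d : ℕ} (T : ℝ) (z : ℝ × E d → ℝ) : Prop :=
  AEStronglyMeasurable z (cyl d T) ∧
    essSup (fun t : ℝ => eLpNorm (fun x : E d => z (t, x)) 2 volume)
      (volume.restrict (Ioo (0 : ℝ) T)) < ⊤

/-- `lim_{t → 0+} ess sup_{s ∈ (0,t)} |(z(s), φ)_{L²}| = 0` for all `φ ∈ C_0^∞(ℝ^d)`. -/
def VanishesWeaklyAtZero {d : ℕ} (z : ℝ × E d → ℝ) : Prop :=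
  ∀ φ : E d → ℝ, ContDiff ℝ ∞ φ → HasCompactSupport φ →
    Tendsto (fun t : ℝ => essSup (fun s : ℝ => ‖∫ x : E d, z (s, x) * φ x‖ₑ)
      (volume.restrict (Ioo (0 : ℝ) t))) (𝓝[>] (0 : ℝ)) (𝓝 0)

end NonlocalFPE

/-! Put z = y₁ - y₂, w = β(y₁) - β(y₂) and q = (b(y₁)y₁ - b(y₂)y₂)D, so that z_t + Ψ(-Δ)w + div q =
0 with zero initial value. Both solutions take values in a compact interval, on which β and r ↦
b(r)r are Lipschitz. Hence |w| and |q| are at most constants times |z|. Moreover wz ≥ αz² with some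
α > 0, or else q = 0 and wz ≥ 0.

The proof is an energy estimate in the regularized dual norm ∫ |ẑ|²/(ε + m) dξ, where m(ξ) =
Ψ(|2πξ|²). Dividing by ε + m turns the diffusion term into -2∫wz, up to an error |ẑ|²/(ε + m) +
ε|ŵ|². The flux costs one derivative. Since s > 1/2, r is negligible against Ψ(r)² for large r, so
that |2πξ|² ≤ δ(Km + Am²) with δ, A as small as desired and K large
(`HasPowerLowerBound.exists_le`). The flux term is then at most δ|q̂|² + A|ẑ|² + K|ẑ|²/(ε + m)
(`energyRate_div_le`). By Plancherel the first two terms are absorbed in 2∫wz. The time weight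
e^{-(2+K)t} absorbs the multiples of the energy and leaves ∬ e^{-(2+K)t}|ẑ|²/(ε + m) ≤ ε ∬
e^{-(2+K)t}w² (`integral_regularized_energy_le`). Letting ε → 0 gives ẑ = 0
(`ae_eq_zero_of_energy_le`).

The estimate is made rigorous one frequency at a time, by testing with plane waves. Subordination
writes Ψ(-Δ) as an integral of second differences against a Lévy measure
(`IsPureJumpBernstein.exists_levyMeasure`, `psiNegLaplacian_eq_integral_secondDiff`). This form
gives bounds uniform in the cutoff, so truncated plane waves converge dominatedly
(`ae_integral_mul_planeWave_eq`). The initial condition enters through the lemma of du Bois-Reymond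
(`ae_eq_integral_of_weak_deriv`). -/

namespace NonlocalFPE

/-! ### Subordination: the symbol of Ψ(-Δ) as a Lévy–Khintchine integral -/

section LevyMeasure

/-- The measure with density f is finite, and dividing by f recovers μ. This makes Fubini available
for the Bernstein measure, which may have infinite mass near 0. -/
theorem sFinite_of_lintegral_ne_top {α : Type*} [MeasurableSpace α] {μ : Measure α}
    {f : α → ENNReal} (hf : Measurable f) (hf0 : ∀ᵐ x ∂μ, f x ≠ 0) (hft : ∀ᵐ x ∂μ, f x ≠ ⊤)
    (h : ∫⁻ x, f x ∂μ ≠ ⊤) : SFinite μ := by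
  have : IsFiniteMeasure (μ.withDensity f) := isFiniteMeasure_withDensity h
  have h2 := withDensity_inv_same hf hf0 hft
  rw [← h2]
  infer_instance

theorem one_sub_cos_inner_le_sq {d : ℕ} (v ξ : E d) :
    1 - Real.cos (2 * Real.pi * inner ℝ v ξ) ≤ (2 * Real.pi * ‖ξ‖) ^ 2 * ‖v‖ ^ 2 := by
  have h1 := Real.one_sub_sq_div_two_le_cos (x := 2 * Real.pi * inner ℝ v ξ)
  have h2 : (2 * Real.pi * inner ℝ v ξ) ^ 2 ≤ (2 * Real.pi * ‖ξ‖) ^ 2 * ‖v‖ ^ 2 := by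
    rw [mul_pow, mul_pow _ ‖ξ‖, mul_assoc, ← mul_pow ‖ξ‖, ← sq_abs (inner ℝ v ξ)]
    gcongr
    rw [mul_comm]; exact abs_real_inner_le_norm v ξ
  nlinarith [sq_nonneg (2 * Real.pi * inner ℝ v ξ)]

theorem one_sub_cos_inner_le {d : ℕ} (v ξ : E d) :
    1 - Real.cos (2 * Real.pi * inner ℝ v ξ) ≤
      (2 + (2 * Real.pi * ‖ξ‖) ^ 2) * min 1 (‖v‖ ^ 2) := by
  have h1 := one_sub_cos_inner_le_sq v ξ
  have h2 := Real.neg_one_le_cos (2 * Real.pi * inner ℝ v ξ)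
  rcases le_total 1 (‖v‖ ^ 2) with h | h
  · rw [min_eq_left h]; nlinarith [sq_nonneg (2 * Real.pi * ‖ξ‖)]
  · rw [min_eq_right h]; nlinarith [sq_nonneg ‖v‖]

theorem integrable_one_sub_cos {d : ℕ} {ν : Measure (E d)}
    (hν : Integrable (fun v => min 1 (‖v‖ ^ 2)) ν) (ξ : E d) :
    Integrable (fun v => 1 - Real.cos (2 * Real.pi * inner ℝ v ξ)) ν := by
  refine (hν.const_mul (2 + (2 * Real.pi * ‖ξ‖) ^ 2)).mono' (by fun_prop) (ae_of_all _ fun v => ?_)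
  rw [Real.norm_of_nonneg (by linarith [Real.cos_le_one (2 * Real.pi * inner ℝ v ξ)])]
  exact one_sub_cos_inner_le v ξ

/-- For a standard Gaussian Y, √(2t)Y has characteristic function exp(-t|η|²); take η = 2πξ and the
real part. -/
theorem integral_one_sub_cos_stdGaussian {d : ℕ} {t : ℝ} (ht : 0 ≤ t) (ξ : E d) :
    ∫ y, (1 - Real.cos (2 * Real.pi * inner ℝ (√(2 * t) • y) ξ))
      ∂(ProbabilityTheory.stdGaussian (E d)) = 1 - Real.exp (-((2 * Real.pi * ‖ξ‖) ^ 2 * t)) := by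
  have hcos : Integrable (fun y : E d => Real.cos (2 * Real.pi * inner ℝ (√(2 * t) • y) ξ))
      (ProbabilityTheory.stdGaussian (E d)) :=
    Integrable.of_bound (by fun_prop) 1 (ae_of_all _ fun y => Real.abs_cos_le_one _)
  rw [integral_sub (integrable_const _) hcos]
  have h := ProbabilityTheory.charFun_stdGaussian (E := E d) ((2 * Real.pi * √(2 * t)) • ξ)
  rw [charFun_apply] at h
  have h' := congrArg Complex.re h
  have hint : Integrable (fun y : E d =>
      Complex.exp (((inner ℝ y ((2 * Real.pi * √(2 * t)) • ξ) : ℝ) : ℂ) * Complex.I))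
      (ProbabilityTheory.stdGaussian (E d)) :=
    Integrable.of_bound (by fun_prop) 1 (ae_of_all _ fun y => by
      rw [Complex.norm_exp_ofReal_mul_I])
  have h3 := integral_re hint
  simp only [RCLike.re_eq_complex_re] at h3
  rw [← h3] at h'
  simp only [Complex.exp_ofReal_mul_I_re] at h'
  have h4 : ∀ y : E d, 2 * Real.pi * inner ℝ (√(2 * t) • y) ξ =
      inner ℝ y ((2 * Real.pi * √(2 * t)) • ξ) := fun y => by
    rw [real_inner_smul_left, real_inner_smul_right]; ring
  simp only [h4, h', integral_const, probReal_univ, smul_eq_mul, mul_one]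
  congr 1
  rw [norm_smul, Real.norm_of_nonneg (by positivity)]
  norm_cast
  congr 1
  rw [mul_pow, mul_pow, Real.sq_sqrt (by positivity)]; ring

/-- Take for ν the image of μ ⊗ Gaussian under (t, y) ↦ √(2t) y, the jump measure of the
subordinated Brownian motion, and integrate the Gaussian identity over t. -/
theorem IsPureJumpBernstein.exists_levyMeasure {Ψ : ℝ → ℝ} (hΨ : IsPureJumpBernstein Ψ) (d : ℕ) :
    ∃ ν : Measure (E d), SFinite ν ∧ Integrable (fun v => min 1 (‖v‖ ^ 2)) ν ∧
      ∀ ξ : E d, Ψ ((2 * Real.pi * ‖ξ‖) ^ 2) =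
        ∫ v, (1 - Real.cos (2 * Real.pi * inner ℝ v ξ)) ∂ν := by
  obtain ⟨μ, hμ, hΨμ⟩ := hΨ
  have hpos : ∀ᵐ t ∂(μ.restrict (Ioi (0 : ℝ))), 0 < t := ae_restrict_mem measurableSet_Ioi
  have : SFinite (μ.restrict (Ioi (0 : ℝ))) := by
    refine sFinite_of_lintegral_ne_top (f := fun t => ENNReal.ofReal (min 1 t)) (by fun_prop)
      ?_ (by simp) hμ.ne
    filter_upwards [hpos] with t ht
    simp [ht]
  set μ' := μ.restrict (Ioi (0 : ℝ)) with hμ'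
  set γ := ProbabilityTheory.stdGaussian (E d) with hγ
  have hμi : Integrable (fun t : ℝ => min 1 t) μ' := by
    refine ⟨by fun_prop, ?_⟩
    rw [hasFiniteIntegral_iff_ofReal]
    · exact hμ
    · filter_upwards [hpos] with t ht
      simp only [Pi.zero_apply]; positivity
  have hγi : Integrable (fun y : E d => 1 + 2 * ‖y‖ ^ 2) γ :=
    (integrable_const _).add
      (((ProbabilityTheory.IsGaussian.memLp_two_id (μ := γ)).integrable_norm_pow
        (by norm_num)).const_mul 2)
  have hmeas : Measurable (fun p : ℝ × E d => √(2 * p.1) • p.2) := by fun_prop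
  have hpp : ∀ᵐ p ∂(μ'.prod γ), 0 < p.1 :=
    Measure.quasiMeasurePreserving_fst.ae hpos
  have hint : Integrable (fun v => min 1 (‖v‖ ^ 2))
      ((μ'.prod γ).map (fun p : ℝ × E d => √(2 * p.1) • p.2)) := by
    rw [integrable_map_measure (by fun_prop) hmeas.aemeasurable]
    -- Since |√(2t) y|² = 2t|y|², the weight is at most min(1, t)(1 + 2|y|²), a product of
    -- integrable factors.
    refine (hμi.mul_prod hγi).mono' (by fun_prop) ?_
    filter_upwards [hpp] with p hp
    simp only [Function.comp]
    rw [Real.norm_of_nonneg (by positivity), norm_smul, mul_pow,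
      Real.norm_of_nonneg (Real.sqrt_nonneg _), Real.sq_sqrt (by positivity)]
    rcases le_total 1 p.1 with h | h
    · rw [min_eq_left h]
      refine (min_le_left _ _).trans ?_
      nlinarith [sq_nonneg ‖p.2‖]
    · rw [min_eq_right h]
      refine (min_le_right _ _).trans ?_
      nlinarith [sq_nonneg ‖p.2‖]
  refine ⟨(μ'.prod γ).map (fun p : ℝ × E d => √(2 * p.1) • p.2), inferInstance, hint, fun ξ => ?_⟩
  have hi := integrable_one_sub_cos hint ξ
  rw [integrable_map_measure (by fun_prop) hmeas.aemeasurable] at hi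
  simp only [Function.comp_def] at hi
  rw [integral_map hmeas.aemeasurable (by fun_prop), integral_prod _ hi, hΨμ _ (by positivity)]
  refine integral_congr_ae ?_
  filter_upwards [hpos] with t ht
  exact (integral_one_sub_cos_stdGaussian ht.le ξ).symm

end LevyMeasure

/-! ### Second differences of test functions -/

section SecondDifference

/-- Half of the negative second-order difference of `f` at `x` in direction `v`. -/
noncomputable def secondDiff {d : ℕ} (f : E d → ℝ) (x v : E d) : ℝ :=
  f x - (f (x + v) + f (x - v)) / 2

theorem abs_secondDiff_le_of_bound {d : ℕ} {f : E d → ℝ} {C : ℝ} (hf : ∀ x, |f x| ≤ C)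
    (x v : E d) : |secondDiff f x v| ≤ 2 * C := by
  have h1 := abs_le.1 (hf x)
  have h2 := abs_le.1 (hf (x + v))
  have h3 := abs_le.1 (hf (x - v))
  unfold secondDiff
  rw [abs_le]
  constructor <;> linarith [h1.1, h1.2, h2.1, h2.2, h3.1, h3.2]

/-- The first-order terms cancel by symmetry: the derivative of u ↦ f(x + u) + f(x - u) is a
difference of gradients at points 2‖u‖ apart, and the gradient is Lipschitz. The mean value
inequality on the ball of radius ‖v‖ concludes. -/
theorem exists_abs_secondDiff_le_sq {d : ℕ} {f : E d → ℝ} (hf : ContDiff ℝ ∞ f)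
    (hfc : HasCompactSupport f) :
    ∃ C : ℝ, 0 ≤ C ∧ ∀ x v, |secondDiff f x v| ≤ C * ‖v‖ ^ 2 := by
  have hf1 : ContDiff ℝ ∞ (fderiv ℝ f) := hf.fderiv_right (by simp)
  obtain ⟨K, hK⟩ := ContDiff.lipschitzWith_of_hasCompactSupport (hfc.fderiv ℝ) hf1 (by simp)
  have hd : Differentiable ℝ f := hf.differentiable (by simp)
  refine ⟨K, K.2, fun x v => ?_⟩
  let g : E d → ℝ := fun u => f (x + u) + f (x - u)
  have hg : ∀ u, HasFDerivAt g (fderiv ℝ f (x + u) - fderiv ℝ f (x - u)) u := fun u => by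
    have h1 : HasFDerivAt (fun u => f (x + u)) (fderiv ℝ f (x + u)) u := by
      have := (hd (x + u)).hasFDerivAt.comp u ((hasFDerivAt_id u).const_add x)
      simpa [Function.comp_def] using this
    have h2 : HasFDerivAt (fun u => f (x - u)) (-fderiv ℝ f (x - u)) u := by
      have := (hd (x - u)).hasFDerivAt.comp u ((hasFDerivAt_id u).const_sub x)
      simpa [Function.comp_def] using this
    rw [sub_eq_add_neg]
    exact h1.add h2
  have hb : ‖g v - g 0‖ ≤ (2 * K * ‖v‖) * ‖v - 0‖ := by
    refine (convex_closedBall (0 : E d) ‖v‖).norm_image_sub_le_of_norm_hasFDerivWithin_le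
      (fun u _ => (hg u).hasFDerivWithinAt) (fun u hu => ?_) (by simp) (by simp)
    rw [mem_closedBall_zero_iff] at hu
    calc ‖fderiv ℝ f (x + u) - fderiv ℝ f (x - u)‖ ≤ K * ‖(x + u) - (x - u)‖ := hK.norm_sub_le _ _
      _ = K * (2 * ‖u‖) := by
        congr 1
        rw [show (x + u) - (x - u) = (2 : ℝ) • u by rw [two_smul]; abel, norm_smul]; simp
      _ ≤ 2 * K * ‖v‖ := by nlinarith [K.2]
  have : secondDiff f x v = -(g v - g 0) / 2 := by simp [secondDiff, g]; ring
  rw [this, abs_div, abs_neg]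
  rw [Real.norm_eq_abs, sub_zero] at hb
  rw [abs_two]
  linarith

theorem exists_abs_secondDiff_le_min {d : ℕ} {f : E d → ℝ} (hf : ContDiff ℝ ∞ f)
    (hfc : HasCompactSupport f) :
    ∃ C : ℝ, 0 ≤ C ∧ ∀ x v, |secondDiff f x v| ≤ C * min 1 (‖v‖ ^ 2) := by
  obtain ⟨C, hC0, hC⟩ := exists_abs_secondDiff_le_sq hf hfc
  obtain ⟨B, hB⟩ := hf.continuous.bounded_above_of_compact_support hfc
  have hB0 : 0 ≤ B := (norm_nonneg _).trans (hB 0)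
  refine ⟨C + 2 * B, by positivity, fun x v => ?_⟩
  have h1 := hC x v
  have h2 := abs_secondDiff_le_of_bound hB x v
  rcases le_total 1 (‖v‖ ^ 2) with h | h
  · rw [min_eq_left h]; linarith
  · rw [min_eq_right h]; nlinarith [sq_nonneg ‖v‖]

/-- The integrated second difference of a test function is an integrable function. -/
theorem integrable_integral_secondDiff {d : ℕ} {ν : Measure (E d)} [SFinite ν]
    (hν : Integrable (fun v => min 1 (‖v‖ ^ 2)) ν) {f : E d → ℝ} (hf : ContDiff ℝ ∞ f)
    (hfc : HasCompactSupport f) : Integrable (fun x => ∫ v, secondDiff f x v ∂ν) volume := by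
  obtain ⟨C, hC0, hC⟩ := exists_abs_secondDiff_le_min hf hfc
  have hcont := hf.continuous
  have hK : IsCompact (tsupport f) := hfc
  set B := tsupport f
  have hBm : MeasurableSet B := hK.measurableSet
  let g : E d → ℝ := B.indicator (fun _ => 1)
  have hg : Integrable g := (integrable_indicator_iff hBm).2
    (integrableOn_const hK.measure_lt_top.ne)
  have hg0 : ∀ x, 0 ≤ g x := fun x => indicator_nonneg (fun _ _ => zero_le_one) x
  have hfg : ∀ x, f x ≠ 0 → g x = 1 := fun x hx => by
    simp [g, B, subset_tsupport f (Function.mem_support.2 hx)]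
  have hgm : Measurable g := measurable_const.indicator hBm
  have hcont2 : Continuous (fun p : E d × E d => secondDiff f p.1 p.2) := by
    unfold secondDiff; fun_prop
  have hmain : Integrable (fun p : E d × E d => secondDiff f p.1 p.2) (volume.prod ν) := by
    -- The second difference vanishes unless one of x, x + v, x - v lies in the support. The sum of
    -- the three indicators has an x-integral that does not depend on v.
    have hdom : Integrable (fun p : E d × E d => (C * min 1 (‖p.2‖ ^ 2)) *
        (g p.1 + g (p.1 + p.2) + g (p.1 - p.2))) (volume.prod ν) := by
      have hG : ∀ v : E d, Integrable (fun x => g x + g (x + v) + g (x - v)) := fun v =>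
        (hg.add (hg.comp_add_right v)).add (hg.comp_sub_right v)
      rw [integrable_prod_iff' (by fun_prop)]
      refine ⟨ae_of_all _ fun v => ?_, ?_⟩
      · exact (hG v).const_mul (C * min 1 (‖v‖ ^ 2))
      · have : ∀ v : E d, ∫ x, ‖(C * min 1 (‖v‖ ^ 2)) * (g x + g (x + v) + g (x - v))‖ =
            (3 * C * ∫ x, g x) * min 1 (‖v‖ ^ 2) := fun v => by
          have h0 : ∀ x, ‖(C * min 1 (‖v‖ ^ 2)) * (g x + g (x + v) + g (x - v))‖ =
              (C * min 1 (‖v‖ ^ 2)) * (g x + g (x + v) + g (x - v)) := fun x => by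
            have h1 := hg0 x
            have h2 := hg0 (x + v)
            have h3 := hg0 (x - v)
            rw [Real.norm_of_nonneg (by positivity)]
          simp only [h0]
          have hA : Integrable (fun x => g x + g (x + v)) := hg.add (hg.comp_add_right v)
          rw [integral_const_mul, integral_add hA (hg.comp_sub_right v),
            integral_add hg (hg.comp_add_right v), integral_add_right_eq_self,
            integral_sub_right_eq_self]
          ring
        simp only [this]
        exact hν.const_mul _
    refine hdom.mono' hcont2.aestronglyMeasurable (ae_of_all _ fun p => ?_)
    obtain ⟨x, v⟩ := p
    have h1 := hg0 x
    have h2 := hg0 (x + v)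
    have h3 := hg0 (x - v)
    have hm : 0 ≤ C * min 1 (‖v‖ ^ 2) := by positivity
    by_cases hz : f x = 0 ∧ f (x + v) = 0 ∧ f (x - v) = 0
    · simp only [secondDiff, hz]
      simp only [add_zero, zero_div, sub_zero, norm_zero]
      positivity
    · have : 1 ≤ g x + g (x + v) + g (x - v) := by
        by_cases ha : f x = 0
        · by_cases hb : f (x + v) = 0
          · have hc : f (x - v) ≠ 0 := fun h => hz ⟨ha, hb, h⟩
            linarith [hfg _ hc]
          · linarith [hfg _ hb]
        · linarith [hfg _ ha]
      exact (hC x v).trans (le_mul_of_one_le_right hm this)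
  exact hmain.integral_prod_left

end SecondDifference

/-! ### Fourier multiplier and jump integral agree on test functions -/

section Multiplier

/-- By Euler's formula, the factor 1 - cos acts on a character as a second difference in x; under
the inverse transform this produces `secondDiff`. -/
theorem one_sub_cos_mul_exp {d : ℕ} (x v ξ : E d) :
    (((1 - Real.cos (2 * Real.pi * inner ℝ v ξ) : ℝ)) : ℂ) *
        Complex.exp (((2 * Real.pi * inner ℝ ξ x : ℝ) : ℂ) * Complex.I) =
      Complex.exp (((2 * Real.pi * inner ℝ ξ x : ℝ) : ℂ) * Complex.I) -
        (Complex.exp (((2 * Real.pi * inner ℝ ξ (x + v) : ℝ) : ℂ) * Complex.I) +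
          Complex.exp (((2 * Real.pi * inner ℝ ξ (x - v) : ℝ) : ℂ) * Complex.I)) / 2 := by
  rw [inner_add_right, inner_sub_right, real_inner_comm ξ v]
  push_cast
  rw [Complex.cos, mul_add, mul_sub, add_mul, sub_mul, sub_mul, Complex.exp_add, Complex.exp_sub,
    neg_mul, Complex.exp_neg]
  field_simp

/-- The operator `Ψ(-Δ)` on test functions as an integrated second difference. -/
theorem psiNegLaplacian_eq_integral_secondDiff {d : ℕ} {Ψ : ℝ → ℝ} {ν : Measure (E d)} [SFinite ν]
    (hν : Integrable (fun v => min 1 (‖v‖ ^ 2)) ν)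
    (hΨν : ∀ ξ : E d, Ψ ((2 * Real.pi * ‖ξ‖) ^ 2) =
      ∫ v, (1 - Real.cos (2 * Real.pi * inner ℝ v ξ)) ∂ν)
    {f : E d → ℝ} (hf : ContDiff ℝ ∞ f) (hfc : HasCompactSupport f) (x : E d) :
    psiNegLaplacian Ψ f x = ∫ v, secondDiff f x v ∂ν := by
  have hF : ContDiff ℝ ∞ (fun y => (f y : ℂ)) := Complex.ofRealCLM.contDiff.comp hf
  have hFc : HasCompactSupport (fun y => (f y : ℂ)) := hfc.comp_left (g := Complex.ofReal) rfl
  let φ : SchwartzMap (E d) ℂ := hFc.toSchwartzMap hF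
  have hφ : (φ : E d → ℂ) = fun y => (f y : ℂ) := rfl
  have hhat : 𝓕 (fun y : E d => (f y : ℂ)) = (𝓕 φ : SchwartzMap (E d) ℂ) := by
    rw [← hφ, SchwartzMap.fourier_coe]
  set ψ : SchwartzMap (E d) ℂ := 𝓕 φ with hψ
  have hinv : ∀ y, ∫ ξ, Complex.exp (((2 * Real.pi * inner ℝ ξ y : ℝ) : ℂ) * Complex.I) * ψ ξ =
      (f y : ℂ) := fun y => by
    have h1 : 𝓕⁻ ψ = φ := FourierTransform.fourierInv_fourier_eq φ
    have h2 : (𝓕⁻ ψ : SchwartzMap (E d) ℂ) y = (f y : ℂ) := by rw [h1]; rfl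
    rw [← h2, SchwartzMap.fourierInv_coe, Real.fourierInv_eq']
    rfl
  have hexpi : ∀ y, Integrable
      (fun ξ => Complex.exp (((2 * Real.pi * inner ℝ ξ y : ℝ) : ℂ) * Complex.I) * ψ ξ) := fun y => by
    refine (ψ.integrable (μ := volume)).norm.mono' ?_ (ae_of_all _ fun ξ => ?_)
    · have := ψ.continuous
      exact Continuous.aestronglyMeasurable (by fun_prop)
    · rw [norm_mul, Complex.norm_exp_ofReal_mul_I, one_mul]
  have hψi : Integrable (fun ξ => (2 + (2 * Real.pi * ‖ξ‖) ^ 2) * ‖ψ ξ‖) := by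
    have h1 := (ψ.integrable_pow_mul volume 2).const_mul ((2 * Real.pi) ^ 2)
    have h2 := ((ψ.integrable (μ := volume)).norm).const_mul 2
    refine (h2.add h1).congr (ae_of_all _ fun ξ => ?_)
    simp only [Pi.add_apply]; ring
  -- Absolute integrability in (ξ, v), needed for Fubini: 1 - cos is at most (2 + |2πξ|²) min(1,
  -- |v|²), and the polynomial factor is absorbed by the Schwartz function.
  have hprod : Integrable (Function.uncurry fun (ξ v : E d) =>
      (((1 - Real.cos (2 * Real.pi * inner ℝ v ξ) : ℝ)) : ℂ) *
        (Complex.exp (((2 * Real.pi * inner ℝ ξ x : ℝ) : ℂ) * Complex.I) * ψ ξ))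
      (volume.prod ν) := by
    refine (hψi.mul_prod hν).mono' ?_ (ae_of_all _ fun p => ?_)
    · have := ψ.continuous
      exact Continuous.aestronglyMeasurable (by simp only [Function.uncurry_def]; fun_prop)
    · have h1 := one_sub_cos_inner_le p.2 p.1
      have h0 : 0 ≤ 1 - Real.cos (2 * Real.pi * inner ℝ p.2 p.1) := by
        linarith [Real.cos_le_one (2 * Real.pi * inner ℝ p.2 p.1)]
      simp only [Function.uncurry_def]
      rw [norm_mul, norm_mul, Complex.norm_exp_ofReal_mul_I, one_mul, Complex.norm_real,
        Real.norm_of_nonneg h0]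
      calc _ ≤ ((2 + (2 * Real.pi * ‖p.1‖) ^ 2) * min 1 (‖p.2‖ ^ 2)) * ‖ψ p.1‖ := by gcongr
        _ = _ := by ring
  have key : (𝓕⁻ (fun ξ : E d =>
      ((Ψ ((2 * Real.pi * ‖ξ‖) ^ 2) : ℝ) : ℂ) * 𝓕 (fun y : E d => ((f y : ℝ) : ℂ)) ξ) x) =
      ((∫ v, secondDiff f x v ∂ν : ℝ) : ℂ) := by
    rw [Real.fourierInv_eq', hhat]
    calc _ = ∫ ξ, ∫ v, (((1 - Real.cos (2 * Real.pi * inner ℝ v ξ) : ℝ)) : ℂ) *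
          (Complex.exp (((2 * Real.pi * inner ℝ ξ x : ℝ) : ℂ) * Complex.I) * ψ ξ) ∂ν := by
          refine integral_congr_ae (ae_of_all _ fun ξ => ?_)
          simp only
          rw [integral_mul_const, integral_complex_ofReal, hΨν ξ, smul_eq_mul]
          ring
      _ = ∫ v, (∫ ξ, (((1 - Real.cos (2 * Real.pi * inner ℝ v ξ) : ℝ)) : ℂ) *
          (Complex.exp (((2 * Real.pi * inner ℝ ξ x : ℝ) : ℂ) * Complex.I) * ψ ξ)) ∂ν :=
          integral_integral_swap hprod
      _ = ∫ v, ((secondDiff f x v : ℝ) : ℂ) ∂ν := by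
          refine integral_congr_ae (ae_of_all _ fun v => ?_)
          simp only
          simp_rw [← mul_assoc, one_sub_cos_mul_exp x v, sub_mul, div_mul_eq_mul_div, add_mul]
          have hs : Integrable (fun ξ =>
              Complex.exp (((2 * Real.pi * inner ℝ ξ (x + v) : ℝ) : ℂ) * Complex.I) * ψ ξ +
              Complex.exp (((2 * Real.pi * inner ℝ ξ (x - v) : ℝ) : ℂ) * Complex.I) * ψ ξ) :=
            (hexpi _).add (hexpi _)
          rw [integral_sub (hexpi x) (hs.div_const 2), integral_div,
            integral_add (hexpi _) (hexpi _), hinv, hinv, hinv, secondDiff]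
          push_cast; ring
      _ = _ := integral_ofReal
  rw [psiNegLaplacian, key, Complex.ofReal_re]

theorem psiNegLaplacian_const_mul {d : ℕ} (Ψ : ℝ → ℝ) (c : ℝ) (f : E d → ℝ) (x : E d) :
    psiNegLaplacian Ψ (fun y => c * f y) x = c * psiNegLaplacian Ψ f x := by
  unfold psiNegLaplacian
  have h1 : 𝓕 (fun y : E d => ((c * f y : ℝ) : ℂ)) = fun ξ => (c : ℂ) * 𝓕 (fun y : E d => (f y : ℂ)) ξ := by
    ext ξ
    rw [Real.fourier_eq, Real.fourier_eq, ← integral_const_mul]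
    congr 1; ext y
    simp only [Circle.smul_def, smul_eq_mul]; push_cast; ring
  rw [h1, Real.fourierInv_eq, Real.fourierInv_eq, ← Complex.re_ofReal_mul, ← integral_const_mul]
  congr 2; ext ξ
  simp only [Circle.smul_def, smul_eq_mul]; ring

end Multiplier

/-! ### Plancherel for the Fourier integral -/

section Plancherel

/-- Plancherel's theorem for the Fourier integral of a function in `L¹ ∩ L²`. -/
theorem memLp_fourier_and_integral_norm_sq_eq {d : ℕ} {f : E d → ℂ} (hf : Integrable f)
    (hf2 : MemLp f 2 volume) :
    MemLp (𝓕 f) 2 volume ∧ ∫ ξ, ‖𝓕 f ξ‖ ^ 2 = ∫ x, ‖f x‖ ^ 2 := by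
  let F : Lp (α := E d) ℂ 2 volume := hf2.toLp f
  have hcont : Continuous (𝓕 f) :=
    VectorFourier.fourierIntegral_continuous Real.continuous_fourierChar
      (by exact continuous_inner) hf
  -- The L² transform and the Fourier integral have equal pairings with smooth compactly supported
  -- functions, because each moves the transform onto the test function.
  have hae : ((𝓕 F : Lp (α := E d) ℂ 2 volume) : E d → ℂ) =ᵐ[volume] 𝓕 f := by
    have hloc1 : LocallyIntegrable ((𝓕 F : Lp (α := E d) ℂ 2 volume) : E d → ℂ) volume :=
      (Lp.memLp _).locallyIntegrable (by norm_num)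
    have := ae_eq_zero_of_integral_contDiff_smul_eq_zero
      (hloc1.sub hcont.locallyIntegrable) (fun g hg hgc => ?_)
    · filter_upwards [this] with x hx
      exact sub_eq_zero.1 hx
    have hG : ContDiff ℝ ∞ (fun y => (g y : ℂ)) := Complex.ofRealCLM.contDiff.comp hg
    have hGc : HasCompactSupport (fun y => (g y : ℂ)) := hgc.comp_left (g := Complex.ofReal) rfl
    let φ : SchwartzMap (E d) ℂ := hGc.toSchwartzMap hG
    have h1 := congrArg (fun T => T φ) (Lp.fourier_toTemperedDistribution_eq F)
    simp only [TemperedDistribution.fourier_apply, Lp.toTemperedDistribution_apply] at h1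
    have h2 : ∫ x, (𝓕 φ : SchwartzMap (E d) ℂ) x • (F : E d → ℂ) x =
        ∫ x, 𝓕 (φ : E d → ℂ) x • f x := by
      refine integral_congr_ae ?_
      filter_upwards [hf2.coeFn_toLp] with x hx
      rw [SchwartzMap.fourier_coe, hx]
    have h3 : ∫ x, 𝓕 (φ : E d → ℂ) x • f x = ∫ x, φ x • 𝓕 f x := by
      have := VectorFourier.integral_fourierIntegral_smul_eq_flip (L := innerₗ (E d))
        (μ := volume) (ν := volume) Real.continuous_fourierChar
        (by exact continuous_inner) (φ.integrable (μ := volume)) hf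
      rw [flip_innerₗ] at this
      exact this
    rw [h2, h3] at h1
    have hi1 : Integrable (fun x => g x • ((𝓕 F : Lp (α := E d) ℂ 2 volume) : E d → ℂ) x) :=
      hloc1.integrable_smul_left_of_hasCompactSupport hg.continuous hgc
    have hi2 : Integrable (fun x => g x • 𝓕 f x) :=
      hcont.locallyIntegrable.integrable_smul_left_of_hasCompactSupport hg.continuous hgc
    simp only [Pi.sub_apply, smul_sub]
    rw [integral_sub hi1 hi2, sub_eq_zero]
    exact h1.symm
  have hm : MemLp (𝓕 f) 2 volume := (memLp_congr_ae hae).1 (Lp.memLp _)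
  refine ⟨hm, ?_⟩
  have hn : ∀ G : Lp (α := E d) ℂ 2 volume, ∫ x, ‖G x‖ ^ 2 = ‖G‖ ^ 2 := fun G => by
    rw [← inner_self_eq_norm_sq (𝕜 := ℂ) G, L2.inner_def, ← integral_re (L2.integrable_inner G G)]
    simp only [inner_self_eq_norm_sq]
  calc ∫ ξ, ‖𝓕 f ξ‖ ^ 2 = ∫ ξ, ‖((𝓕 F : Lp (α := E d) ℂ 2 volume) : E d → ℂ) ξ‖ ^ 2 := by
        refine integral_congr_ae ?_
        filter_upwards [hae] with x hx
        rw [hx]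
    _ = ‖F‖ ^ 2 := by rw [hn, Lp.norm_fourier_eq]
    _ = ∫ x, ‖f x‖ ^ 2 := by
        rw [← hn]
        refine integral_congr_ae ?_
        filter_upwards [hf2.coeFn_toLp] with x hx
        rw [hx]

end Plancherel

/-! ### Weak derivatives in time and the initial value -/

section WeakDerivative

theorem exists_Icc_superset_of_isCompact {T : ℝ} (hT : 0 < T) {K : Set ℝ} (hK : IsCompact K)
    (hKT : K ⊆ Ioo 0 T) : ∃ a b : ℝ, 0 < a ∧ b < T ∧ K ⊆ Icc a b := by
  rcases K.eq_empty_or_nonempty with rfl | hne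
  · exact ⟨T / 2, T / 2, by linarith, by linarith, empty_subset _⟩
  · obtain ⟨a, ha⟩ := hK.exists_isLeast hne
    obtain ⟨b, hb⟩ := hK.exists_isGreatest hne
    exact ⟨a, b, (hKT ha.1).1, (hKT hb.1).2, fun x hx => ⟨ha.2 hx, hb.2 hx⟩⟩

/-- A smooth function with vanishing integral and compact support in `(0,T)` is the derivative
of a smooth function with compact support in `(0,T)`. -/
theorem exists_contDiff_deriv_eq {T : ℝ} {h : ℝ → ℝ} (hh : ContDiff ℝ ∞ h)
    {a b : ℝ} (ha : 0 < a) (hb : b < T) (hs : Function.support h ⊆ Icc a b)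
    (h0 : ∫ t in (0 : ℝ)..T, h t = 0) :
    ∃ θ : ℝ → ℝ, ContDiff ℝ ∞ θ ∧ HasCompactSupport θ ∧ tsupport θ ⊆ Ioo 0 T ∧ deriv θ = h := by
  have hc := hh.continuous
  have hi : ∀ x y, IntervalIntegrable h volume x y := fun x y => hc.intervalIntegrable x y
  have hd : deriv (fun t => ∫ s in (0 : ℝ)..t, h s) = h := by
    ext t
    exact hc.deriv_integral h 0 t
  have hz : ∀ t, t ∉ Icc a b → h t = 0 := fun t ht => by
    by_contra hne
    exact ht (hs hne)
  have hsupp : Function.support (fun t => ∫ s in (0 : ℝ)..t, h s) ⊆ Icc a b := by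
    intro t ht
    by_contra hn
    refine ht ?_
    simp only
    rcases lt_or_ge t a with hta | hta
    · rw [intervalIntegral.integral_congr (g := fun _ => (0 : ℝ)), intervalIntegral.integral_zero]
      intro s hs
      refine hz s fun hs' => ?_
      have : s ≤ max 0 t := hs.2
      have := max_lt ha hta
      linarith [hs'.1]
    · have htb : b < t := not_le.1 fun h => hn ⟨hta, h⟩
      have h1 : ∫ s in T..t, h s = 0 := by
        rw [intervalIntegral.integral_congr (g := fun _ => (0 : ℝ)), intervalIntegral.integral_zero]
        intro s hs
        refine hz s fun hs' => ?_
        have h2 : min T t ≤ s := hs.1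
        have := lt_min hb htb
        linarith [hs'.2]
      rw [← intervalIntegral.integral_add_adjacent_intervals (hi 0 T) (hi T t), h0, h1, add_zero]
  have htsupp : tsupport (fun t => ∫ s in (0 : ℝ)..t, h s) ⊆ Icc a b :=
    closure_minimal hsupp isClosed_Icc
  refine ⟨fun t => ∫ s in (0 : ℝ)..t, h s, ?_, HasCompactSupport.of_support_subset_isCompact isCompact_Icc hsupp,
    htsupp.trans (Icc_subset_Ioo ha hb), hd⟩
  rw [contDiff_infty_iff_deriv, hd]
  exact ⟨fun t => (hc.integral_hasStrictDerivAt 0 t).hasDerivAt.differentiableAt, hh⟩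

theorem absolutelyContinuousOnInterval_of_contDiff {θ : ℝ → ℝ} (hθ : ContDiff ℝ ∞ θ) (a b : ℝ) :
    AbsolutelyContinuousOnInterval θ a b :=
  ContDiffOn.absolutelyContinuousOnInterval (hθ.of_le (by simp)).contDiffOn

theorem ae_deriv_integral_eq {T : ℝ} (hT : 0 < T) {k : ℝ → ℝ}
    (hk : IntervalIntegrable k volume 0 T) :
    ∀ᵐ t, t ∈ Ioc 0 T → HasDerivAt (fun t => ∫ s in (0 : ℝ)..t, k s) (k t) t := by
  filter_upwards [hk.ae_hasDerivAt_integral] with t ht h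
  rw [uIcc_of_le hT.le] at ht
  exact ht ⟨h.1.le, h.2⟩ 0 ⟨le_rfl, hT.le⟩

/-- The lemma of du Bois-Reymond, for a weak derivative in `L¹(0,T)`. -/
theorem exists_ae_eq_const_add_integral {T : ℝ} (hT : 0 < T) {m k : ℝ → ℝ}
    (hm : IntegrableOn m (Ioo 0 T)) (hk : IntegrableOn k (Ioo 0 T))
    (h : ∀ θ : ℝ → ℝ, ContDiff ℝ ∞ θ → HasCompactSupport θ → tsupport θ ⊆ Ioo 0 T →
      ∫ t in Ioo 0 T, (m t * deriv θ t + k t * θ t) = 0) :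
    ∃ c : ℝ, ∀ᵐ t ∂volume.restrict (Ioo 0 T), m t = c + ∫ s in (0 : ℝ)..t, k s := by
  have hki : IntervalIntegrable k volume 0 T :=
    (intervalIntegrable_iff_integrableOn_Ioo_of_le hT.le).2 hk
  set K : ℝ → ℝ := fun t => ∫ s in (0 : ℝ)..t, k s with hK
  have hKac : AbsolutelyContinuousOnInterval K 0 T :=
    hki.absolutelyContinuousOnInterval_intervalIntegral (by simp)
  have hKc : ContinuousOn K (Icc 0 T) := by
    have := hKac.continuousOn
    rwa [uIcc_of_le hT.le] at this
  have hKi : IntegrableOn K (Ioo 0 T) :=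
    (hKc.integrableOn_compact isCompact_Icc).mono_set Ioo_subset_Icc_self
  -- Subtracting the primitive of k leaves a function with vanishing weak derivative, to be shown
  -- constant.
  set n : ℝ → ℝ := fun t => m t - K t with hn
  have hni : IntegrableOn n (Ioo 0 T) := hm.sub hKi
  have hmul : ∀ {u : ℝ → ℝ} {g : ℝ → ℝ}, IntegrableOn u (Ioo 0 T) → Continuous g →
      HasCompactSupport g → IntegrableOn (fun t => u t * g t) (Ioo 0 T) := by
    intro u g hu hg hgc
    obtain ⟨B, hB⟩ := hg.bounded_above_of_compact_support hgc
    exact Integrable.mul_bdd (c := B) hu hg.aestronglyMeasurable (ae_of_all _ hB)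
  have h1 : ∀ θ : ℝ → ℝ, ContDiff ℝ ∞ θ → HasCompactSupport θ → tsupport θ ⊆ Ioo 0 T →
      ∫ t in Ioo 0 T, n t * deriv θ t = 0 := by
    intro θ hθ hθc hθT
    have hθ' : Continuous (deriv θ) := hθ.continuous_deriv (by simp)
    have hb : ∀ t, t ∉ Ioo 0 T → θ t = 0 := fun t ht =>
      image_eq_zero_of_notMem_tsupport fun h => ht (hθT h)
    have h2 := hKac.integral_mul_deriv_eq_deriv_mul
      (absolutelyContinuousOnInterval_of_contDiff hθ 0 T)
    rw [hb 0 (by simp), hb T (by simp), mul_zero, mul_zero, sub_zero, zero_sub] at h2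
    have h3 : ∫ t in (0 : ℝ)..T, deriv K t * θ t = ∫ t in (0 : ℝ)..T, k t * θ t := by
      refine intervalIntegral.integral_congr_ae ?_
      filter_upwards [ae_deriv_integral_eq hT hki] with t ht ht2
      rw [uIoc_of_le hT.le] at ht2
      rw [(ht ht2).deriv]
    rw [h3, intervalIntegral.integral_of_le hT.le, intervalIntegral.integral_of_le hT.le,
      integral_Ioc_eq_integral_Ioo, integral_Ioc_eq_integral_Ioo] at h2
    have h4 := h θ hθ hθc hθT
    rw [integral_add (hmul hm hθ' hθc.deriv) (hmul hk hθ.continuous hθc)] at h4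
    simp only [hn, sub_mul]
    rw [integral_sub (hmul hm hθ' hθc.deriv) (hmul hKi hθ' hθc.deriv)]
    linarith
  -- A unit-mass bump supported in (0,T). For any test function ψ, ψ - (∫ψ)θ₀ has mean zero, hence
  -- is an admissible derivative; this identifies the constant as ∫ n θ₀.
  let B : ContDiffBump (T / 2) := ⟨T / 8, T / 4, by positivity, by linarith⟩
  set θ₀ : ℝ → ℝ := B.normed volume with hθ₀
  have hθ₀s : tsupport θ₀ ⊆ Ioo 0 T := by
    rw [hθ₀, B.tsupport_normed_eq, Real.closedBall_eq_Icc]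
    exact Icc_subset_Ioo (by simp only [B]; linarith) (by simp only [B]; linarith)
  have hθ₀d : ContDiff ℝ ∞ θ₀ := B.contDiff_normed
  have hθ₀c : HasCompactSupport θ₀ := B.hasCompactSupport_normed
  have hint : ∀ {g : ℝ → ℝ}, tsupport g ⊆ Ioo 0 T → ∫ t in (0 : ℝ)..T, g t = ∫ t, g t := by
    intro g hg
    exact intervalIntegral.integral_eq_integral_of_support_subset
      ((subset_tsupport g).trans (hg.trans Ioo_subset_Ioc_self))
  have hθ₀1 : ∫ t, θ₀ t = 1 := B.integral_normed
  refine ⟨∫ t in Ioo 0 T, n t * θ₀ t, ?_⟩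
  set c := ∫ t in Ioo 0 T, n t * θ₀ t with hc
  have hkey : ∀ᵐ t ∂(volume.restrict (Ioo 0 T)), t ∈ Ioo 0 T → n t - c = 0 := by
    have hnc : IntegrableOn (fun t => n t - c) (Ioo 0 T) :=
      hni.sub (integrableOn_const (by simp))
    refine isOpen_Ioo.ae_eq_zero_of_integral_contDiff_smul_eq_zero ?_ ?_
    · exact (show Integrable (fun t => n t - c) (volume.restrict (Ioo 0 T)) from
        hnc).locallyIntegrable.locallyIntegrableOn _
    intro ψ hψ hψc hψT
    obtain ⟨a, b, ha, hb, hsub⟩ := exists_Icc_superset_of_isCompact hT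
      (hψc.isCompact.union hθ₀c.isCompact) (union_subset hψT hθ₀s)
    obtain ⟨θ, hθ, hθc, hθT, hθd⟩ := exists_contDiff_deriv_eq
      (h := fun t => ψ t - (∫ s, ψ s) * θ₀ t) (hψ.sub (contDiff_const.mul hθ₀d)) ha hb
      (by
        intro t ht
        by_contra hn
        refine ht ?_
        have h1 : ψ t = 0 := image_eq_zero_of_notMem_tsupport fun h => hn (hsub (Or.inl h))
        have h2 : θ₀ t = 0 := image_eq_zero_of_notMem_tsupport fun h => hn (hsub (Or.inr h))
        simp [h1, h2])
      (by
        rw [intervalIntegral.integral_sub (hψ.continuous.intervalIntegrable _ _)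
          ((hθ₀d.continuous.intervalIntegrable _ _).const_mul _),
          intervalIntegral.integral_const_mul, hint hψT, hint hθ₀s, hθ₀1, mul_one, sub_self])
    have h5 := h1 θ hθ hθc hθT
    simp only [hθd, mul_sub] at h5
    have hi1 := hmul hni hψ.continuous hψc
    have hi2 : IntegrableOn (fun t => n t * ((∫ s, ψ s) * θ₀ t)) (Ioo 0 T) :=
      hmul hni (continuous_const.mul hθ₀d.continuous) hθ₀c.mul_left
    rw [integral_sub hi1 hi2] at h5
    have h6 : ∫ t in Ioo 0 T, n t * ((∫ s, ψ s) * θ₀ t) = (∫ s, ψ s) * c := by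
      rw [hc, ← integral_const_mul]
      congr 1; ext t; ring
    have h7 : ∫ t in Ioo 0 T, ψ t = ∫ s, ψ s := by
      rw [← hint hψT, intervalIntegral.integral_of_le hT.le, integral_Ioc_eq_integral_Ioo]
    have hψi : IntegrableOn ψ (Ioo 0 T) := (hψ.continuous.integrable_of_hasCompactSupport hψc).integrableOn
    simp only [smul_eq_mul, mul_sub]
    have h8 : ∫ t in Ioo 0 T, ψ t * n t = ∫ t in Ioo 0 T, n t * ψ t := by
      congr 1; ext t; ring
    have hi3 : IntegrableOn (fun t => ψ t * n t) (Ioo 0 T) := by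
      simpa only [mul_comm] using hi1
    rw [integral_sub hi3 (hψi.mul_const c), integral_mul_const, h7, h8]
    linarith
  filter_upwards [hkey, ae_restrict_mem measurableSet_Ioo] with t ht ht2
  have := ht ht2
  simp only [hn] at this
  linarith

/-- A function with weak derivative `k ∈ L¹(0,T)` that vanishes at `0+` in the sense of the
essential supremum is the primitive of `k`. -/
theorem ae_eq_integral_of_weak_deriv {T : ℝ} (hT : 0 < T) {m k : ℝ → ℝ}
    (hm : IntegrableOn m (Ioo 0 T)) (hk : IntegrableOn k (Ioo 0 T))
    (h : ∀ θ : ℝ → ℝ, ContDiff ℝ ∞ θ → HasCompactSupport θ → tsupport θ ⊆ Ioo 0 T →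
      ∫ t in Ioo 0 T, (m t * deriv θ t + k t * θ t) = 0)
    (h0 : Tendsto (fun t : ℝ => essSup (fun s => ‖m s‖ₑ) (volume.restrict (Ioo (0 : ℝ) t)))
      (𝓝[>] (0 : ℝ)) (𝓝 0)) :
    ∀ᵐ t ∂volume.restrict (Ioo 0 T), m t = ∫ s in (0 : ℝ)..t, k s := by
  obtain ⟨c, hc⟩ := exists_ae_eq_const_add_integral hT hm hk h
  suffices c = 0 by simpa [this] using hc
  -- If c ≠ 0, the primitive is smaller than |c|/2 near 0, so |m| > |c|/2 there almost everywhere.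
  -- This contradicts the vanishing essential supremum, since (0,t) has positive measure.
  by_contra hc0
  have hki : IntervalIntegrable k volume 0 T :=
    (intervalIntegrable_iff_integrableOn_Ioo_of_le hT.le).2 hk
  have hKc : ContinuousOn (fun t => ∫ s in (0 : ℝ)..t, k s) (Icc 0 T) := by
    have := (hki.absolutelyContinuousOnInterval_intervalIntegral (c := 0) (by simp)).continuousOn
    rwa [uIcc_of_le hT.le] at this
  have hpos : 0 < |c| / 2 := by positivity
  have hK0 : ∀ᶠ t in 𝓝[>] (0 : ℝ), t ∈ Ioo 0 T ∧ |∫ s in (0 : ℝ)..t, k s| < |c| / 2 := by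
    have h1 : Tendsto (fun t => ∫ s in (0 : ℝ)..t, k s) (𝓝[>] 0) (𝓝 0) := by
      have := (hKc 0 ⟨le_rfl, hT.le⟩).tendsto
      simp only [intervalIntegral.integral_same] at this
      refine this.mono_left ?_
      rw [← nhdsWithin_Ioo_eq_nhdsGT hT]
      exact nhdsWithin_mono _ Ioo_subset_Icc_self
    have h2 := (tendsto_order.1 h1.abs).2 (|c| / 2) (by simpa using hpos)
    filter_upwards [h2, Ioo_mem_nhdsGT hT] with t h3 h4
    exact ⟨h4, h3⟩
  obtain ⟨r, hr0, hr⟩ := mem_nhdsGT_iff_exists_Ioo_subset.1 hK0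
  have hS := (tendsto_order.1 h0).2 (ENNReal.ofReal (|c| / 2)) (by simpa using hpos)
  obtain ⟨t, ht, htr⟩ := (hS.and (Ioo_mem_nhdsGT hr0)).exists
  have hsub : Ioo 0 t ⊆ Ioo 0 r := Ioo_subset_Ioo_right htr.2.le
  have hae : ∀ᵐ s ∂volume.restrict (Ioo 0 t), False := by
    have hsubT : Ioo 0 t ⊆ Ioo 0 T := fun s hs => (hr (hsub hs)).1
    filter_upwards [ENNReal.ae_le_essSup (μ := volume.restrict (Ioo 0 t)) (fun s => ‖m s‖ₑ),
      ae_restrict_of_ae_restrict_of_subset hsubT hc, ae_restrict_mem measurableSet_Ioo]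
      with s h1 h2 h3
    have h4 := h1.trans_lt ht
    have h5 := (hr (hsub h3)).2
    rw [← ofReal_norm, ENNReal.ofReal_lt_ofReal_iff hpos, Real.norm_eq_abs, h2] at h4
    have h6 := abs_sub_abs_le_abs_sub c (-∫ s in (0 : ℝ)..s, k s)
    rw [abs_neg, sub_neg_eq_add] at h6
    linarith
  rw [ae_iff] at hae
  simp at hae
  linarith [htr.1]

end WeakDerivative

/-! ### Weighted energy in time -/

section Energy

/-- The weighted energy inequality for an absolutely continuous function with initial value `0`. -/
theorem weighted_energy_le {T : ℝ} (hT : 0 < T) {g : ℝ → ℝ} (hg : IntegrableOn g (Ioo 0 T))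
    (lam : ℝ) :
    IntegrableOn (fun t => Real.exp (-lam * t) * (∫ s in (0 : ℝ)..t, g s) ^ 2) (Ioo 0 T) ∧
    IntegrableOn (fun t => Real.exp (-lam * t) * (2 * g t * ∫ s in (0 : ℝ)..t, g s)) (Ioo 0 T) ∧
    lam * ∫ t in Ioo 0 T, Real.exp (-lam * t) * (∫ s in (0 : ℝ)..t, g s) ^ 2 ≤
      ∫ t in Ioo 0 T, Real.exp (-lam * t) * (2 * g t * ∫ s in (0 : ℝ)..t, g s) := by
  have hgi : IntervalIntegrable g volume 0 T :=
    (intervalIntegrable_iff_integrableOn_Ioo_of_le hT.le).2 hg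
  set G : ℝ → ℝ := fun t => ∫ s in (0 : ℝ)..t, g s with hG
  have hGac : AbsolutelyContinuousOnInterval G 0 T :=
    hgi.absolutelyContinuousOnInterval_intervalIntegral (by simp)
  have hGc : ContinuousOn G (uIcc 0 T) := hGac.continuousOn
  have he : ContDiff ℝ ∞ (fun t : ℝ => Real.exp (-lam * t)) := by fun_prop
  have heac := absolutelyContinuousOnInterval_of_contDiff he 0 T
  -- Integrate the derivative of exp(-λt) G(t)². The boundary term vanishes at 0 and is nonnegative
  -- at T, where it is dropped.
  have h1 := heac.integral_deriv_mul_eq_sub (hGac.fun_mul hGac)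
  have hde : ∀ t, HasDerivAt (fun t : ℝ => Real.exp (-lam * t)) (-lam * Real.exp (-lam * t)) t :=
    fun t => by
      have := ((hasDerivAt_id t).const_mul (-lam)).exp
      simpa [mul_comm] using this
  have h2 : ∫ t in (0 : ℝ)..T, deriv (fun t : ℝ => Real.exp (-lam * t)) t * (G t * G t) +
        Real.exp (-lam * t) * deriv (fun t => G t * G t) t =
      ∫ t in (0 : ℝ)..T, (Real.exp (-lam * t) * (2 * g t * G t) -
        lam * (Real.exp (-lam * t) * G t ^ 2)) := by
    refine intervalIntegral.integral_congr_ae ?_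
    filter_upwards [ae_deriv_integral_eq hT hgi] with t ht ht2
    rw [uIoc_of_le hT.le] at ht2
    have h3 : HasDerivAt G (g t) t := ht ht2
    rw [(hde t).deriv, (h3.fun_mul h3).deriv]
    ring
  have hi1 : IntervalIntegrable (fun t => Real.exp (-lam * t) * (2 * g t * G t)) volume 0 T :=
    ((hgi.const_mul 2).mul_continuousOn hGc).continuousOn_mul he.continuous.continuousOn
  have hi2 : IntervalIntegrable (fun t => Real.exp (-lam * t) * G t ^ 2) volume 0 T :=
    (he.continuous.continuousOn.mul (hGc.pow 2)).intervalIntegrable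
  rw [h2, intervalIntegral.integral_sub hi1 (hi2.const_mul lam), intervalIntegral.integral_const_mul,
    intervalIntegral.integral_of_le hT.le, intervalIntegral.integral_of_le hT.le,
    integral_Ioc_eq_integral_Ioo, integral_Ioc_eq_integral_Ioo] at h1
  have hG0 : G 0 = 0 := by simp [hG]
  rw [hG0] at h1
  have : 0 ≤ Real.exp (-lam * T) * (G T * G T) := by
    have := mul_self_nonneg (G T)
    positivity
  exact ⟨(intervalIntegrable_iff_integrableOn_Ioo_of_le hT.le).1 hi2,
    (intervalIntegrable_iff_integrableOn_Ioo_of_le hT.le).1 hi1, by linarith⟩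

end Energy

/-! ### Real plane waves -/

section PlaneWave

/-- The real plane wave with frequency `ξ` and phase `a`. -/
noncomputable def planeWave {d : ℕ} (ξ : E d) (a : ℝ) (x : E d) : ℝ :=
  Real.cos (2 * Real.pi * inner ℝ x ξ + a)

theorem contDiff_planeWave {d : ℕ} (ξ : E d) (a : ℝ) : ContDiff ℝ ∞ (planeWave ξ a) := by
  unfold planeWave
  exact Real.contDiff_cos.comp
    ((contDiff_const.mul (contDiff_id.inner ℝ contDiff_const)).add contDiff_const)

theorem abs_planeWave_le_one {d : ℕ} (ξ : E d) (a : ℝ) (x : E d) : |planeWave ξ a x| ≤ 1 :=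
  Real.abs_cos_le_one _

theorem fderiv_planeWave_apply {d : ℕ} (ξ : E d) (a : ℝ) (x h : E d) :
    fderiv ℝ (planeWave ξ a) x h =
      -(Real.sin (2 * Real.pi * inner ℝ x ξ + a) * (2 * Real.pi * inner ℝ h ξ)) := by
  have h1 : HasFDerivAt (fun x : E d => 2 * Real.pi * inner ℝ x ξ + a)
      ((2 * Real.pi) • innerSL ℝ ξ) x := by
    have := (((innerSL ℝ ξ).hasFDerivAt (x := x)).const_mul (2 * Real.pi)).add_const a
    simpa only [innerSL_apply_apply, real_inner_comm ξ] using this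
  have h2 : HasFDerivAt (planeWave ξ a) _ x := h1.cos
  rw [h2.fderiv]
  simp only [smul_apply, innerSL_apply_apply, smul_eq_mul, real_inner_comm ξ]
  ring

theorem norm_fderiv_planeWave_le {d : ℕ} (ξ : E d) (a : ℝ) (x : E d) :
    ‖fderiv ℝ (planeWave ξ a) x‖ ≤ 2 * Real.pi * ‖ξ‖ := by
  refine ContinuousLinearMap.opNorm_le_bound _ (by positivity) fun h => ?_
  rw [fderiv_planeWave_apply, norm_neg, norm_mul, norm_mul, Real.norm_eq_abs, Real.norm_eq_abs,
    Real.norm_eq_abs, abs_of_pos (by positivity : 0 < 2 * Real.pi)]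
  have h1 := abs_real_inner_le_norm h ξ
  have h2 := Real.abs_sin_le_one (2 * Real.pi * inner ℝ x ξ + a)
  calc _ ≤ 1 * (2 * Real.pi * (‖h‖ * ‖ξ‖)) := by gcongr
    _ = _ := by ring

theorem abs_planeWave_sub_le {d : ℕ} (ξ : E d) (a : ℝ) (x y : E d) :
    |planeWave ξ a x - planeWave ξ a y| ≤ 2 * Real.pi * ‖ξ‖ * ‖x - y‖ :=
  convex_univ.norm_image_sub_le_of_norm_fderiv_le
    (fun x _ => (contDiff_planeWave ξ a).differentiable (by simp) x)
    (fun x _ => norm_fderiv_planeWave_le ξ a x) (mem_univ y) (mem_univ x)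

/-- Plane waves are eigenfunctions of the second difference, because the sine terms of the addition
formulas cancel. Integrating the eigenvalue over v gives the symbol. -/
theorem secondDiff_planeWave {d : ℕ} (ξ : E d) (a : ℝ) (x v : E d) :
    secondDiff (planeWave ξ a) x v =
      planeWave ξ a x * (1 - Real.cos (2 * Real.pi * inner ℝ v ξ)) := by
  unfold secondDiff planeWave
  rw [inner_add_left, inner_sub_left, mul_add, mul_sub,
    show 2 * Real.pi * inner ℝ x ξ + 2 * Real.pi * inner ℝ v ξ + a =
      (2 * Real.pi * inner ℝ x ξ + a) + 2 * Real.pi * inner ℝ v ξ by ring,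
    show 2 * Real.pi * inner ℝ x ξ - 2 * Real.pi * inner ℝ v ξ + a =
      (2 * Real.pi * inner ℝ x ξ + a) - 2 * Real.pi * inner ℝ v ξ by ring,
    Real.cos_add (_ + a), Real.cos_sub (_ + a)]
  ring

theorem abs_secondDiff_planeWave_le {d : ℕ} (ξ : E d) (a : ℝ) (x v : E d) :
    |secondDiff (planeWave ξ a) x v| ≤ (2 * Real.pi * ‖ξ‖) ^ 2 * ‖v‖ ^ 2 := by
  have h1 := one_sub_cos_inner_le_sq v ξ
  have h0 : 0 ≤ 1 - Real.cos (2 * Real.pi * inner ℝ v ξ) := by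
    linarith [Real.cos_le_one (2 * Real.pi * inner ℝ v ξ)]
  rw [secondDiff_planeWave, abs_mul, abs_of_nonneg h0]
  calc _ ≤ 1 * ((2 * Real.pi * ‖ξ‖) ^ 2 * ‖v‖ ^ 2) :=
        mul_le_mul (abs_planeWave_le_one ξ a x) h1 h0 zero_le_one
    _ = _ := one_mul _

end PlaneWave

/-! ### Truncation of plane waves with uniform bounds -/

section Cutoff

theorem secondDiff_mul {d : ℕ} (f g : E d → ℝ) (x v : E d) :
    secondDiff (fun y => f y * g y) x v = secondDiff f x v * g x + f x * secondDiff g x v -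
      ((f (x + v) - f x) * (g (x + v) - g x) + (f (x - v) - f x) * (g (x - v) - g x)) / 2 := by
  unfold secondDiff
  ring

/-- In the discrete Leibniz rule the cross terms are products of two first differences, so two
Lipschitz bounds make them quadratic in ‖v‖. -/
theorem abs_secondDiff_mul_le {d : ℕ} {f g : E d → ℝ} {K₁ K₂ C₁ C₂ : ℝ} (hK₁ : 0 ≤ K₁)
    (hf : ∀ x, |f x| ≤ 1) (hg : ∀ x, |g x| ≤ 1)
    (hfK : ∀ x y, |f x - f y| ≤ K₁ * ‖x - y‖) (hgK : ∀ x y, |g x - g y| ≤ K₂ * ‖x - y‖)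
    (hfC : ∀ x v, |secondDiff f x v| ≤ C₁ * ‖v‖ ^ 2)
    (hgC : ∀ x v, |secondDiff g x v| ≤ C₂ * ‖v‖ ^ 2) (x v : E d) :
    |secondDiff (fun y => f y * g y) x v| ≤ (C₁ + C₂ + K₁ * K₂) * ‖v‖ ^ 2 := by
  have h1 : |secondDiff f x v * g x| ≤ C₁ * ‖v‖ ^ 2 := by
    rw [abs_mul]
    calc _ ≤ (C₁ * ‖v‖ ^ 2) * 1 :=
          mul_le_mul (hfC x v) (hg x) (abs_nonneg _) ((abs_nonneg _).trans (hfC x v))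
      _ = _ := mul_one _
  have h2 : |f x * secondDiff g x v| ≤ C₂ * ‖v‖ ^ 2 := by
    rw [abs_mul]
    calc _ ≤ 1 * (C₂ * ‖v‖ ^ 2) := mul_le_mul (hf x) (hgC x v) (abs_nonneg _) zero_le_one
      _ = _ := one_mul _
  have h3 : ∀ y, ‖y - x‖ = ‖v‖ → |(f y - f x) * (g y - g x)| ≤ K₁ * K₂ * ‖v‖ ^ 2 := fun y hy => by
    rw [abs_mul]
    calc _ ≤ (K₁ * ‖y - x‖) * (K₂ * ‖y - x‖) :=
          mul_le_mul (hfK y x) (hgK y x) (abs_nonneg _) (by positivity)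
      _ = _ := by rw [hy]; ring
  have h4 := h3 (x + v) (by simp)
  have h5 := h3 (x - v) (by simp)
  rw [secondDiff_mul]
  rw [abs_le] at *
  constructor <;> linarith [h1.1, h1.2, h2.1, h2.2, h4.1, h4.2, h5.1, h5.2]

/-- There is a sequence of smooth compactly supported cutoff functions, with uniform bounds, which
are eventually equal to `1` near each point. -/
theorem exists_cutoff (d : ℕ) : ∃ (χ : ℕ → E d → ℝ) (K C : ℝ), 0 ≤ K ∧ 0 ≤ C ∧
    (∀ n, ContDiff ℝ ∞ (χ n)) ∧ (∀ n, HasCompactSupport (χ n)) ∧ (∀ n x, |χ n x| ≤ 1) ∧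
    (∀ n x y, |χ n x - χ n y| ≤ K * ‖x - y‖) ∧
    (∀ n x v, |secondDiff (χ n) x v| ≤ C * ‖v‖ ^ 2) ∧
    ∀ x, ∀ᶠ n in atTop, χ n =ᶠ[𝓝 x] fun _ => 1 := by
  let B : ContDiffBump (0 : E d) := ⟨1, 2, one_pos, one_lt_two⟩
  have hBd : ContDiff ℝ ∞ B := B.contDiff
  have hBc : HasCompactSupport B := B.hasCompactSupport
  obtain ⟨K, hK⟩ := ContDiff.lipschitzWith_of_hasCompactSupport hBc hBd (by simp)
  obtain ⟨C, hC0, hC⟩ := exists_abs_secondDiff_le_sq hBd hBc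
  -- The cutoffs are dilations of one bump. The scaling factor is at most 1 and only shrinks
  -- increments, so the constants of the undilated bump serve for every n.
  have hr : ∀ n : ℕ, 0 < ((n : ℝ) + 1)⁻¹ := fun n => by positivity
  have hr1 : ∀ n : ℕ, ((n : ℝ) + 1)⁻¹ ≤ 1 := fun n => inv_le_one_of_one_le₀ (by simp)
  have hnorm : ∀ (n : ℕ) (v : E d), ‖((n : ℝ) + 1)⁻¹ • v‖ ≤ ‖v‖ := fun n v => by
    rw [norm_smul, Real.norm_of_nonneg (hr n).le]
    exact mul_le_of_le_one_left (norm_nonneg _) (hr1 n)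
  refine ⟨fun n x => B (((n : ℝ) + 1)⁻¹ • x), K, C, K.2, hC0, fun n => ?_, fun n => ?_,
    fun n x => ?_, fun n x y => ?_, fun n x v => ?_, fun x => ?_⟩
  · exact hBd.comp (contDiff_const_smul _)
  · exact hBc.comp_smul (hr n).ne'
  · rw [abs_of_nonneg B.nonneg]
    exact B.le_one
  · have := hK.norm_sub_le (((n : ℝ) + 1)⁻¹ • x) (((n : ℝ) + 1)⁻¹ • y)
    rw [← smul_sub] at this
    exact this.trans (mul_le_mul_of_nonneg_left (hnorm n _) K.2)
  · have := hC (((n : ℝ) + 1)⁻¹ • x) (((n : ℝ) + 1)⁻¹ • v)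
    unfold secondDiff at this ⊢
    simp only
    rw [smul_add, smul_sub]
    refine this.trans (mul_le_mul_of_nonneg_left ?_ hC0)
    exact pow_le_pow_left₀ (norm_nonneg _) (hnorm n v) 2
  · obtain ⟨N, hN⟩ := exists_nat_gt ‖x‖
    filter_upwards [eventually_ge_atTop N] with n hn
    have hn' : ‖x‖ < (n : ℝ) + 1 := by
      have : (N : ℝ) ≤ n := by exact_mod_cast hn
      linarith
    filter_upwards [(continuous_norm.tendsto x).eventually (gt_mem_nhds hn')] with y hy
    refine B.one_of_mem_closedBall ?_
    rw [mem_closedBall_zero_iff, norm_smul, Real.norm_of_nonneg (hr n).le]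
    change _ ≤ (1 : ℝ)
    rw [inv_mul_le_one₀ (by positivity)]
    exact hy.le

/-- Test functions approximating a plane wave, with uniform bounds that make the dominated
convergence theorem applicable in the weak formulation. -/
theorem exists_testFunction_tendsto_planeWave {d : ℕ} {ν : Measure (E d)}
    (hν : Integrable (fun v => min 1 (‖v‖ ^ 2)) ν) (ξ : E d) (a : ℝ) :
    ∃ (f : ℕ → E d → ℝ) (C : ℝ), (∀ n, ContDiff ℝ ∞ (f n)) ∧ (∀ n, HasCompactSupport (f n)) ∧
      (∀ n x, |f n x| ≤ 1) ∧ (∀ n x, ‖fderiv ℝ (f n) x‖ ≤ C) ∧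
      (∀ n x, |∫ v, secondDiff (f n) x v ∂ν| ≤ C) ∧
      (∀ x, Tendsto (fun n => f n x) atTop (𝓝 (planeWave ξ a x))) ∧
      (∀ x h, Tendsto (fun n => fderiv ℝ (f n) x h) atTop
        (𝓝 (fderiv ℝ (planeWave ξ a) x h))) ∧
      (∀ x, Tendsto (fun n => ∫ v, secondDiff (f n) x v ∂ν) atTop
        (𝓝 (planeWave ξ a x * ∫ v, (1 - Real.cos (2 * Real.pi * inner ℝ v ξ)) ∂ν))) := by
  obtain ⟨χ, K, C, hK0, hC0, hχd, hχc, hχ1, hχK, hχC, hχlim⟩ := exists_cutoff d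
  set e := planeWave ξ a with he
  have hed := contDiff_planeWave ξ a
  set K₂ := 2 * Real.pi * ‖ξ‖ with hK₂
  have hK₂0 : 0 ≤ K₂ := by positivity
  set f : ℕ → E d → ℝ := fun n x => χ n x * e x with hf
  have hfd : ∀ n, ContDiff ℝ ∞ (f n) := fun n => (hχd n).mul hed
  have hf1 : ∀ n x, |f n x| ≤ 1 := fun n x => by
    rw [hf, abs_mul]
    exact mul_le_one₀ (hχ1 n x) (abs_nonneg _) (abs_planeWave_le_one ξ a x)
  have hfK : ∀ n x y, |f n x - f n y| ≤ (K + K₂) * ‖x - y‖ := fun n x y => by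
    have h1 : f n x - f n y = (χ n x - χ n y) * e x + χ n y * (e x - e y) := by simp only [hf]; ring
    rw [h1]
    refine (abs_add_le _ _).trans ?_
    rw [abs_mul, abs_mul, add_mul]
    refine add_le_add ?_ ?_
    · calc _ ≤ (K * ‖x - y‖) * 1 := mul_le_mul (hχK n x y) (abs_planeWave_le_one ξ a x)
            (abs_nonneg _) (by positivity)
        _ = _ := mul_one _
    · calc _ ≤ 1 * (K₂ * ‖x - y‖) := mul_le_mul (hχ1 n y) (abs_planeWave_sub_le ξ a x y)
            (abs_nonneg _) zero_le_one
        _ = _ := one_mul _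
  -- The first three terms come from the product estimate, used for ‖v‖ ≤ 1; the 2 is the crude
  -- bound from |f n| ≤ 1, used for ‖v‖ ≥ 1.
  set C' := C + K₂ ^ 2 + K * K₂ + 2 with hC'
  have hC'0 : 0 ≤ C' := by positivity
  have hfs : ∀ n x v, |secondDiff (f n) x v| ≤ C' * min 1 (‖v‖ ^ 2) := fun n x v => by
    have h1 := abs_secondDiff_mul_le hK0 (hχ1 n) (abs_planeWave_le_one ξ a) (hχK n)
      (abs_planeWave_sub_le ξ a) (hχC n) (abs_secondDiff_planeWave_le ξ a) x v
    have h2 := abs_secondDiff_le_of_bound (hf1 n) x v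
    have h3 : 0 ≤ C + K₂ ^ 2 + K * K₂ := by positivity
    rcases le_total 1 (‖v‖ ^ 2) with h | h
    · rw [min_eq_left h]; linarith
    · rw [min_eq_right h]
      refine h1.trans ?_
      nlinarith [sq_nonneg ‖v‖]
  -- Equality on a neighbourhood, not just at the point, so that the derivatives are eventually
  -- equal too.
  have hfe : ∀ x, ∀ᶠ n in atTop, f n =ᶠ[𝓝 x] e := fun x => by
    filter_upwards [hχlim x] with n hn
    filter_upwards [hn] with y hy
    simp [hf, hy]
  have hfl : ∀ x, Tendsto (fun n => f n x) atTop (𝓝 (e x)) := fun x =>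
    tendsto_const_nhds.congr' (by filter_upwards [hfe x] with n hn using hn.self_of_nhds.symm)
  have hI0 : 0 ≤ ∫ v, min 1 (‖v‖ ^ 2) ∂ν := integral_nonneg fun v => by positivity
  refine ⟨f, K + K₂ + C' * ∫ v, min 1 (‖v‖ ^ 2) ∂ν, hfd, fun n => (hχc n).mul_right, hf1,
    fun n x => ?_, fun n x => ?_, hfl, fun x h => ?_, fun x => ?_⟩
  · have : LipschitzWith (K + K₂).toNNReal (f n) := LipschitzWith.of_dist_le_mul fun x y => by
      rw [Real.coe_toNNReal _ (by positivity), Real.dist_eq, dist_eq_norm]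
      exact hfK n x y
    have h1 := norm_fderiv_le_of_lipschitz ℝ this (x₀ := x)
    rw [Real.coe_toNNReal _ (by positivity)] at h1
    exact h1.trans (le_add_of_nonneg_right (by positivity))
  · have h1 := norm_integral_le_of_norm_le (f := secondDiff (f n) x) (hν.const_mul C')
      (ae_of_all _ fun v => hfs n x v)
    refine h1.trans ?_
    rw [integral_const_mul]
    exact le_add_of_nonneg_left (by positivity)
  · refine tendsto_const_nhds.congr' ?_
    filter_upwards [hfe x] with n hn
    rw [hn.fderiv_eq]
  · have : ∫ v, secondDiff e x v ∂ν =
        e x * ∫ v, (1 - Real.cos (2 * Real.pi * inner ℝ v ξ)) ∂ν := by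
      rw [← integral_const_mul]
      exact integral_congr_ae (ae_of_all _ fun v => secondDiff_planeWave ξ a x v)
    rw [← this]
    refine tendsto_integral_of_dominated_convergence _ (fun n => ?_) (hν.const_mul C')
      (fun n => ae_of_all _ fun v => hfs n x v) (ae_of_all _ fun v => ?_)
    · have := (hfd n).continuous
      unfold secondDiff
      exact Continuous.aestronglyMeasurable (by fun_prop)
    · exact (hfl x).sub (((hfl _).add (hfl _)).div_const 2)

end Cutoff

/-! ### The equation for the difference, tested with plane waves -/

section WeakForm

theorem cyl_eq_restrict {d : ℕ} {t T : ℝ} (htT : t ≤ T) :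
    cyl d t = (cyl d T).restrict (Ioo 0 t ×ˢ univ) := by
  have h := Measure.prod_restrict (μ := volume.restrict (Ioo (0 : ℝ) T))
    (ν := (volume : Measure (E d))) (Ioo 0 t) univ
  rw [Measure.restrict_univ, Measure.restrict_restrict measurableSet_Ioo,
    inter_eq_left.2 (Ioo_subset_Ioo_right htT)] at h
  exact h

theorem cyl_mono {d : ℕ} {t T : ℝ} (htT : t ≤ T) : cyl d t ≤ cyl d T := by
  rw [cyl_eq_restrict htT]
  exact Measure.restrict_le_self

theorem integral_cyl_eq_intervalIntegral {d : ℕ} {t : ℝ} (ht : 0 ≤ t) {F : Type*}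
    [NormedAddCommGroup F] [NormedSpace ℝ F] {g : ℝ × E d → F} (hg : Integrable g (cyl d t)) :
    ∫ p, g p ∂(cyl d t) = ∫ s in (0 : ℝ)..t, ∫ x, g (s, x) := by
  rw [integral_prod _ hg, intervalIntegral.integral_of_le ht, integral_Ioc_eq_integral_Ioo]

theorem inner_gradient_eq_fderiv {d : ℕ} (f : E d → ℝ) (x h : E d) :
    inner ℝ h (∇ f x) = fderiv ℝ f x h := by
  rw [real_inner_comm, gradient, InnerProductSpace.toDual_symm_apply]

theorem ae_norm_le_of_memLp_top {α F : Type*} [MeasurableSpace α] [NormedAddCommGroup F]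
    {μ : Measure α} {u : α → F} (hu : MemLp u ⊤ μ) :
    ∀ᵐ p ∂μ, ‖u p‖ ≤ (eLpNormEssSup u μ).toReal := by
  have hfin : eLpNormEssSup u μ ≠ ⊤ := by
    have := hu.2.ne
    rwa [eLpNorm_exponent_top] at this
  filter_upwards [enorm_ae_le_eLpNormEssSup u μ] with p hp
  rw [← toReal_enorm]
  exact ENNReal.toReal_mono hfin hp

/-- A continuous function of an essentially bounded function is essentially bounded. -/
theorem exists_ae_norm_comp_le {α : Type*} [MeasurableSpace α] {μ : Measure α} {u : α → ℝ}
    (hu : MemLp u ⊤ μ) {g : ℝ → ℝ} (hg : Continuous g) : ∃ C, ∀ᵐ p ∂μ, ‖g (u p)‖ ≤ C := by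
  obtain ⟨C, hC⟩ := isCompact_Icc (a := -(eLpNormEssSup u μ).toReal) (b := (eLpNormEssSup u μ).toReal)
    |>.exists_bound_of_continuousOn hg.continuousOn
  refine ⟨C, ?_⟩
  filter_upwards [ae_norm_le_of_memLp_top hu] with p hp
  exact hC _ (abs_le.1 hp)

theorem integrable_comp_mul {α : Type*} [MeasurableSpace α] {μ : Measure α} {u : α → ℝ}
    (hu : MemLp u ⊤ μ) {g : ℝ → ℝ} (hg : Continuous g) {h : α → ℝ} (hh : Integrable h μ) :
    Integrable (fun p => g (u p) * h p) μ := by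
  obtain ⟨C, hC⟩ := exists_ae_norm_comp_le hu hg
  exact hh.bdd_mul (hg.comp_aestronglyMeasurable hu.1) hC

variable {d : ℕ} {T : ℝ}

theorem integrable_fderiv_apply {D : E d → E d} (hD : MemLp D ⊤ volume) {f : E d → ℝ}
    (hf : ContDiff ℝ ∞ f) (hfc : HasCompactSupport f) :
    Integrable (fun x => fderiv ℝ f x (D x)) := by
  have hc : Continuous (fderiv ℝ f) := hf.continuous_fderiv (by simp)
  have h1 : Integrable (fderiv ℝ f) := hc.integrable_of_hasCompactSupport (hfc.fderiv ℝ)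
  refine (h1.norm.mul_const (eLpNormEssSup D volume).toReal).mono' ?_ ?_
  · exact isBoundedBilinearMap_apply.continuous.comp_aestronglyMeasurable (h1.1.prodMk hD.1)
  · filter_upwards [ae_norm_le_of_memLp_top hD] with x hx
    exact (ContinuousLinearMap.le_opNorm _ _).trans (by gcongr)

/-- The weak formulation tested with a product `θ(t) f(x)`, together with the integrability of
its integrand. -/
theorem IsDistributionalSolution.integrable_and_integral_eq_zero {Ψ β b : ℝ → ℝ} {D : E d → E d}
    {u : ℝ × E d → ℝ} (hsol : IsDistributionalSolution T Ψ β b D u)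
    (hβ : Continuous β) (hb : Continuous b) (hD : MemLp D ⊤ volume) (hu : MemLp u ⊤ (cyl d T))
    {θ : ℝ → ℝ} (hθ : ContDiff ℝ ∞ θ) (hθc : HasCompactSupport θ) (hθT : tsupport θ ⊆ Ioo 0 T)
    {f : E d → ℝ} (hf : ContDiff ℝ ∞ f) (hfc : HasCompactSupport f)
    (hL : Integrable (psiNegLaplacian Ψ f)) :
    Integrable (fun p : ℝ × E d => u p * (deriv θ p.1 * f p.2)
      - β (u p) * (θ p.1 * psiNegLaplacian Ψ f p.2)
      + b (u p) * u p * (θ p.1 * fderiv ℝ f p.2 (D p.2))) (cyl d T) ∧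
    ∫ p : ℝ × E d, (u p * (deriv θ p.1 * f p.2)
      - β (u p) * (θ p.1 * psiNegLaplacian Ψ f p.2)
      + b (u p) * u p * (θ p.1 * fderiv ℝ f p.2 (D p.2))) ∂(cyl d T) = 0 := by
  constructor
  · have hθi : Integrable θ (volume.restrict (Ioo 0 T)) :=
      (hθ.continuous.integrable_of_hasCompactSupport hθc).integrableOn
    have hθ'i : Integrable (deriv θ) (volume.restrict (Ioo 0 T)) :=
      ((hθ.continuous_deriv (by simp)).integrable_of_hasCompactSupport hθc.deriv).integrableOn
    have hfi : Integrable f := hf.continuous.integrable_of_hasCompactSupport hfc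
    refine ((integrable_comp_mul hu continuous_id (hθ'i.mul_prod hfi)).sub
      (integrable_comp_mul hu hβ (hθi.mul_prod hL))).add
      (integrable_comp_mul hu (hb.mul continuous_id)
        (hθi.mul_prod (integrable_fderiv_apply hD hf hfc)))
  · have h := hsol (fun p => θ p.1 * f p.2)
      ((hθ.comp contDiff_fst).mul (hf.comp contDiff_snd)) ?_ ?_
    · rw [← h]
      refine integral_congr_ae (ae_of_all _ fun p => ?_)
      have h1 : deriv (fun τ : ℝ => θ τ * f p.2) p.1 = deriv θ p.1 * f p.2 :=
        deriv_mul_const (hθ.differentiable (by simp) _) _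
      have h2 : fderiv ℝ (fun y => θ p.1 * f y) p.2 = θ p.1 • fderiv ℝ f p.2 :=
        fderiv_const_mul (hf.differentiable (by simp) _) _
      simp only [h1, psiNegLaplacian_const_mul, inner_gradient_eq_fderiv, h2, smul_apply,
        smul_eq_mul]
      ring
    · refine HasCompactSupport.of_support_subset_isCompact (hθc.isCompact.prod hfc.isCompact) ?_
      intro p hp
      exact ⟨subset_tsupport _ (left_ne_zero_of_mul hp), subset_tsupport _ (right_ne_zero_of_mul hp)⟩
    · have : tsupport (fun p : ℝ × E d => θ p.1 * f p.2) ⊆ tsupport θ ×ˢ tsupport f := by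
        refine closure_minimal ?_ ((isClosed_tsupport θ).prod (isClosed_tsupport f))
        intro p hp
        exact ⟨subset_tsupport _ (left_ne_zero_of_mul hp),
          subset_tsupport _ (right_ne_zero_of_mul hp)⟩
      exact this.trans (prod_mono hθT (subset_univ _))

/-- The integrated form in time of the equation for the difference of two solutions. -/
theorem ae_integral_mul_eq_of_isDistributionalSolution (hT : 0 < T) {Ψ β b : ℝ → ℝ}
    {D : E d → E d} {y₁ y₂ : ℝ × E d → ℝ}
    (hβ : Continuous β) (hb : Continuous b) (hD : MemLp D ⊤ volume)
    (hy₁ : MemLp y₁ ⊤ (cyl d T)) (hy₂ : MemLp y₂ ⊤ (cyl d T))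
    (hsol₁ : IsDistributionalSolution T Ψ β b D y₁)
    (hsol₂ : IsDistributionalSolution T Ψ β b D y₂)
    (hz₁ : Integrable (y₁ - y₂) (cyl d T)) (hz₀ : VanishesWeaklyAtZero (y₁ - y₂))
    {f : E d → ℝ} (hf : ContDiff ℝ ∞ f) (hfc : HasCompactSupport f)
    (hL : Integrable (psiNegLaplacian Ψ f)) :
    ∀ᵐ t ∂volume.restrict (Ioo 0 T), ∫ x, (y₁ (t, x) - y₂ (t, x)) * f x =
      ∫ p, (-((β (y₁ p) - β (y₂ p)) * psiNegLaplacian Ψ f p.2) +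
        fderiv ℝ f p.2 ((b (y₁ p) * y₁ p - b (y₂ p) * y₂ p) • D p.2)) ∂(cyl d t) := by
  set k : ℝ × E d → ℝ := fun p => -((β (y₁ p) - β (y₂ p)) * psiNegLaplacian Ψ f p.2) +
        fderiv ℝ f p.2 ((b (y₁ p) * y₁ p - b (y₂ p) * y₂ p) • D p.2) with hk
  have hki : Integrable k (cyl d T) := by
    have hLi : Integrable (fun p : ℝ × E d => psiNegLaplacian Ψ f p.2) (cyl d T) := hL.comp_snd _
    have hDi : Integrable (fun p : ℝ × E d => fderiv ℝ f p.2 (D p.2)) (cyl d T) :=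
      (integrable_fderiv_apply hD hf hfc).comp_snd _
    refine (((integrable_comp_mul hy₂ hβ hLi).sub (integrable_comp_mul hy₁ hβ hLi)).add
      ((integrable_comp_mul hy₁ (hb.mul continuous_id) hDi).sub
        (integrable_comp_mul hy₂ (hb.mul continuous_id) hDi))).congr (ae_of_all _ fun p => ?_)
    simp only [hk, Pi.add_apply, Pi.sub_apply, map_smul, smul_eq_mul, Pi.mul_apply, id]
    ring
  have hmi : Integrable (fun p : ℝ × E d => (y₁ p - y₂ p) * f p.2) (cyl d T) := by
    obtain ⟨B, hB⟩ := hf.continuous.bounded_above_of_compact_support hfc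
    exact Integrable.mul_bdd (c := B) hz₁
      (hf.continuous.comp continuous_snd).aestronglyMeasurable (ae_of_all _ fun p => hB p.2)
  have hmain : ∀ᵐ t ∂volume.restrict (Ioo 0 T), ∫ x, (y₁ (t, x) - y₂ (t, x)) * f x =
      ∫ s in (0 : ℝ)..t, ∫ x, k (s, x) := by
    -- Subtracting the two weak formulations for the test function θ(t)f(x) gives the weak time
    -- derivative of the pairing with f; the initial condition fixes the constant of integration.
    refine ae_eq_integral_of_weak_deriv hT (m := fun t => ∫ x, (y₁ (t, x) - y₂ (t, x)) * f x)
      (k := fun s => ∫ x, k (s, x)) hmi.integral_prod_left hki.integral_prod_left ?_ (hz₀ f hf hfc)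
    intro θ hθ hθc hθT
    obtain ⟨hi₁, h₁⟩ := hsol₁.integrable_and_integral_eq_zero hβ hb hD hy₁ hθ hθc hθT hf hfc hL
    obtain ⟨hi₂, h₂⟩ := hsol₂.integrable_and_integral_eq_zero hβ hb hD hy₂ hθ hθc hθT hf hfc hL
    have h3 := integral_sub hi₁ hi₂
    rw [h₁, h₂, sub_zero] at h3
    have h4 : ∀ p : ℝ × E d, (y₁ p * (deriv θ p.1 * f p.2)
      - β (y₁ p) * (θ p.1 * psiNegLaplacian Ψ f p.2)
      + b (y₁ p) * y₁ p * (θ p.1 * fderiv ℝ f p.2 (D p.2))) - (y₂ p * (deriv θ p.1 * f p.2)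
      - β (y₂ p) * (θ p.1 * psiNegLaplacian Ψ f p.2)
      + b (y₂ p) * y₂ p * (θ p.1 * fderiv ℝ f p.2 (D p.2))) =
      ((y₁ p - y₂ p) * f p.2) * deriv θ p.1 + k p * θ p.1 := fun p => by
        simp only [hk, map_smul, smul_eq_mul]; ring
    have hi3 := hi₁.sub hi₂
    simp only [h4] at h3
    have hi4 : Integrable (fun p : ℝ × E d =>
        ((y₁ p - y₂ p) * f p.2) * deriv θ p.1 + k p * θ p.1) (cyl d T) :=
      hi3.congr (ae_of_all _ fun p => h4 p)
    rw [integral_prod _ hi4] at h3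
    refine Eq.trans ?_ h3
    refine integral_congr_ae ?_
    filter_upwards [hmi.prod_right_ae, hki.prod_right_ae] with t ht1 ht2
    rw [integral_add (ht1.mul_const _) (ht2.mul_const _), integral_mul_const, integral_mul_const]
  filter_upwards [hmain, ae_restrict_mem measurableSet_Ioo] with t ht htT
  rw [ht, integral_cyl_eq_intervalIntegral htT.1.le (hki.mono_measure (cyl_mono htT.2.le))]

/-- Passing to the limit from test functions to plane waves. -/
theorem ae_integral_mul_planeWave_eq {ν : Measure (E d)} [SFinite ν]
    (hν : Integrable (fun v => min 1 (‖v‖ ^ 2)) ν) {z w : ℝ × E d → ℝ} {q : ℝ × E d → E d}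
    (hz : Integrable z (cyl d T)) (hw : Integrable w (cyl d T)) (hq : Integrable q (cyl d T))
    (h : ∀ f : E d → ℝ, ContDiff ℝ ∞ f → HasCompactSupport f →
      ∀ᵐ t ∂volume.restrict (Ioo 0 T), ∫ x, z (t, x) * f x =
        ∫ p, (-(w p * ∫ v, secondDiff f p.2 v ∂ν) + fderiv ℝ f p.2 (q p)) ∂(cyl d t))
    (ξ : E d) (a : ℝ) :
    ∀ᵐ t ∂volume.restrict (Ioo 0 T), ∫ x, z (t, x) * planeWave ξ a x =
      ∫ p, (-(w p * (planeWave ξ a p.2 * ∫ v, (1 - Real.cos (2 * Real.pi * inner ℝ v ξ)) ∂ν)) +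
        fderiv ℝ (planeWave ξ a) p.2 (q p)) ∂(cyl d t) := by
  obtain ⟨f, C, hfd, hfc, hf1, hfD, hfL, hlim, hlimD, hlimL⟩ :=
    exists_testFunction_tendsto_planeWave hν ξ a
  -- The exceptional set of times depends on the test function; only countably many are used, so one
  -- null set suffices.
  have hall : ∀ᵐ t ∂volume.restrict (Ioo 0 T), ∀ n, ∫ x, z (t, x) * f n x =
        ∫ p, (-(w p * ∫ v, secondDiff (f n) p.2 v ∂ν) + fderiv ℝ (f n) p.2 (q p)) ∂(cyl d t) :=
    ae_all_iff.2 fun n => h (f n) (hfd n) (hfc n)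
  filter_upwards [hall, hz.prod_right_ae, ae_restrict_mem measurableSet_Ioo] with t ht hzt htT
  have hle : cyl d t ≤ cyl d T := cyl_mono htT.2.le
  have hwt := hw.mono_measure hle
  have hqt := hq.mono_measure hle
  have hl : Tendsto (fun n => ∫ x, z (t, x) * f n x) atTop
      (𝓝 (∫ x, z (t, x) * planeWave ξ a x)) := by
    refine tendsto_integral_of_dominated_convergence (fun x => ‖z (t, x)‖) (fun n => ?_) hzt.norm
      (fun n => ae_of_all _ fun x => ?_) (ae_of_all _ fun x => (hlim x).const_mul _)
    · exact hzt.1.mul (hfd n).continuous.aestronglyMeasurable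
    · rw [norm_mul]
      exact mul_le_of_le_one_right (norm_nonneg _) (hf1 n x)
  refine tendsto_nhds_unique hl ?_
  simp only [ht]
  refine tendsto_integral_of_dominated_convergence (fun p => C * ‖w p‖ + C * ‖q p‖)
    (fun n => ?_) ((hwt.norm.const_mul C).add (hqt.norm.const_mul C))
    (fun n => ae_of_all _ fun p => ?_) (ae_of_all _ fun p => ?_)
  · have h1 : Continuous (fderiv ℝ (f n)) := (hfd n).continuous_fderiv (by simp)
    exact (hwt.1.mul (integrable_integral_secondDiff hν (hfd n) (hfc n)).1.comp_snd).neg.add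
      (isBoundedBilinearMap_apply.continuous.comp_aestronglyMeasurable
        ((h1.comp continuous_snd).aestronglyMeasurable.prodMk hqt.1))
  · refine (norm_add_le _ _).trans (add_le_add ?_ ?_)
    · rw [norm_neg, norm_mul, mul_comm]
      exact mul_le_mul_of_nonneg_right (hfL n _) (norm_nonneg _)
    · exact (ContinuousLinearMap.le_opNorm _ _).trans
        (mul_le_mul_of_nonneg_right (hfD n _) (norm_nonneg _))
  · exact (((hlimL p.2).const_mul (w p)).neg).add (hlimD p.2 (q p))

end WeakForm

/-! ### Spatial Fourier transform and Parseval on the cylinder -/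

section SpatialFourier

variable {d : ℕ} {T : ℝ}

/-- The Fourier transform in the space variable of a real function on `ℝ × ℝ^d`. -/
noncomputable def spatialFourier (z : ℝ × E d → ℝ) (p : ℝ × E d) : ℂ :=
  𝓕 (fun x : E d => (z (p.1, x) : ℂ)) p.2

theorem spatialFourier_eq_integral (z : ℝ × E d → ℝ) (p : ℝ × E d) :
    spatialFourier z p =
      ∫ x, Complex.exp (((-2 * Real.pi * inner ℝ x p.2 : ℝ) : ℂ) * Complex.I) * (z (p.1, x) : ℂ) := by
  rw [spatialFourier, Real.fourier_eq']
  rfl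

theorem aestronglyMeasurable_spatialFourier {z : ℝ × E d → ℝ}
    (hz : AEStronglyMeasurable z (cyl d T)) :
    AEStronglyMeasurable (spatialFourier z) (cyl d T) := by
  have h1 : AEStronglyMeasurable (fun r : (ℝ × E d) × E d => z (r.1.1, r.2))
      ((cyl d T).prod volume) :=
    hz.comp_quasiMeasurePreserving
      (QuasiMeasurePreserving.prodMap Measure.quasiMeasurePreserving_fst (.id _))
  have h2 : AEStronglyMeasurable (fun r : (ℝ × E d) × E d =>
      Complex.exp (((-2 * Real.pi * inner ℝ r.2 r.1.2 : ℝ) : ℂ) * Complex.I) *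
        (z (r.1.1, r.2) : ℂ)) ((cyl d T).prod volume) :=
    AEStronglyMeasurable.mul (Continuous.aestronglyMeasurable (by fun_prop))
      (Complex.continuous_ofReal.comp_aestronglyMeasurable h1)
  refine h2.integral_prod_right'.congr (ae_of_all _ fun p => ?_)
  exact (spatialFourier_eq_integral z p).symm

theorem integrable_exp_mul {x : E d} {f : E d → ℝ} (hf : Integrable f) :
    Integrable (fun y => Complex.exp (((-2 * Real.pi * inner ℝ y x : ℝ) : ℂ) * Complex.I) *
      (f y : ℂ)) := by
  refine hf.ofReal.bdd_mul (c := 1) (Continuous.aestronglyMeasurable (by fun_prop))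
    (ae_of_all _ fun y => ?_)
  rw [Complex.norm_exp_ofReal_mul_I]

theorem spatialFourier_add {z w : ℝ × E d → ℝ} {p : ℝ × E d}
    (hz : Integrable fun x => z (p.1, x)) (hw : Integrable fun x => w (p.1, x)) :
    spatialFourier (z + w) p = spatialFourier z p + spatialFourier w p := by
  simp only [spatialFourier_eq_integral]
  rw [← integral_add (integrable_exp_mul hz) (integrable_exp_mul hw)]
  congr 1; ext x
  simp only [Pi.add_apply]; push_cast; ring

theorem spatialFourier_sub {z w : ℝ × E d → ℝ} {p : ℝ × E d}
    (hz : Integrable fun x => z (p.1, x)) (hw : Integrable fun x => w (p.1, x)) :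
    spatialFourier (z - w) p = spatialFourier z p - spatialFourier w p := by
  simp only [spatialFourier_eq_integral]
  rw [← integral_sub (integrable_exp_mul hz) (integrable_exp_mul hw)]
  congr 1; ext x
  simp only [Pi.sub_apply]; push_cast; ring

theorem spatialFourier_re {z : ℝ × E d → ℝ} {p : ℝ × E d}
    (hz : Integrable fun x => z (p.1, x)) :
    (spatialFourier z p).re = ∫ x, z (p.1, x) * planeWave p.2 0 x := by
  rw [spatialFourier_eq_integral, ← RCLike.re_eq_complex_re, ← integral_re (integrable_exp_mul hz)]
  congr 1; ext x
  rw [RCLike.re_eq_complex_re, Complex.re_mul_ofReal, Complex.exp_ofReal_mul_I_re, planeWave,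
    add_zero, ← Real.cos_neg, mul_comm]
  congr 2; ring

theorem spatialFourier_im {z : ℝ × E d → ℝ} {p : ℝ × E d}
    (hz : Integrable fun x => z (p.1, x)) :
    (spatialFourier z p).im = ∫ x, z (p.1, x) * planeWave p.2 (Real.pi / 2) x := by
  rw [spatialFourier_eq_integral, ← RCLike.im_eq_complex_im, ← integral_im (integrable_exp_mul hz)]
  congr 1; ext x
  rw [RCLike.im_eq_complex_im, Complex.im_mul_ofReal, Complex.exp_ofReal_mul_I_im, planeWave,
    Real.cos_add_pi_div_two, ← Real.sin_neg, mul_comm]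
  congr 2; ring

theorem ae_integral_norm_sq_spatialFourier {z : ℝ × E d → ℝ} (hz : Integrable z (cyl d T))
    (hz2 : Integrable (fun p => z p ^ 2) (cyl d T)) :
    ∀ᵐ t ∂volume.restrict (Ioo 0 T), Integrable (fun ξ => ‖spatialFourier z (t, ξ)‖ ^ 2) ∧
      ∫ ξ, ‖spatialFourier z (t, ξ)‖ ^ 2 = ∫ x, z (t, x) ^ 2 := by
  filter_upwards [hz.prod_right_ae, hz2.prod_right_ae] with t h1 h2
  have h3 : MemLp (fun x => z (t, x)) 2 volume := (memLp_two_iff_integrable_sq h1.1).2 h2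
  have h4 : MemLp (fun x => (z (t, x) : ℂ)) 2 volume := h3.ofReal
  obtain ⟨h5, h6⟩ := memLp_fourier_and_integral_norm_sq_eq h1.ofReal h4
  refine ⟨(memLp_two_iff_integrable_sq_norm h5.1).1 h5, ?_⟩
  calc _ = ∫ x, ‖(z (t, x) : ℂ)‖ ^ 2 := h6
    _ = _ := by
      congr 1; ext x
      rw [Complex.norm_real, Real.norm_eq_abs, sq_abs]

theorem integrable_norm_sq_spatialFourier {z : ℝ × E d → ℝ} (hz : Integrable z (cyl d T))
    (hz2 : Integrable (fun p => z p ^ 2) (cyl d T)) :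
    Integrable (fun p => ‖spatialFourier z p‖ ^ 2) (cyl d T) := by
  have hm : AEStronglyMeasurable (fun p => ‖spatialFourier z p‖ ^ 2) (cyl d T) :=
    (aestronglyMeasurable_spatialFourier hz.1).norm.pow 2
  have h := ae_integral_norm_sq_spatialFourier hz hz2
  rw [integrable_prod_iff hm]
  refine ⟨by filter_upwards [h] with t ht using ht.1, hz2.integral_prod_left.congr ?_⟩
  filter_upwards [h] with t ht
  rw [← ht.2]
  congr 1; ext ξ
  rw [Real.norm_of_nonneg (by positivity)]

theorem ae_cyl_mem_Ioo : ∀ᵐ p ∂(cyl d T), p.1 ∈ Ioo 0 T :=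
  Measure.quasiMeasurePreserving_fst.ae (ae_restrict_mem measurableSet_Ioo)

theorem exp_neg_mul_le_one {lam t : ℝ} (hl : 0 ≤ lam) (ht : 0 ≤ t) : Real.exp (-lam * t) ≤ 1 :=
  Real.exp_le_one_iff.2 (by nlinarith)

theorem integrable_exp_mul_cyl {lam : ℝ} (hl : 0 ≤ lam) {g : ℝ × E d → ℝ}
    (hg : Integrable g (cyl d T)) :
    Integrable (fun p => Real.exp (-lam * p.1) * g p) (cyl d T) := by
  refine hg.bdd_mul (c := 1) (Continuous.aestronglyMeasurable (by fun_prop)) ?_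
  filter_upwards [ae_cyl_mem_Ioo] with p hp
  rw [Real.norm_of_nonneg (Real.exp_nonneg _)]
  exact exp_neg_mul_le_one hl hp.1.le

/-- Plancherel's theorem on the cylinder with a weight in time. -/
theorem integral_exp_mul_norm_sq_spatialFourier {lam : ℝ} (hl : 0 ≤ lam) {z : ℝ × E d → ℝ}
    (hz : Integrable z (cyl d T)) (hz2 : Integrable (fun p => z p ^ 2) (cyl d T)) :
    ∫ p, Real.exp (-lam * p.1) * ‖spatialFourier z p‖ ^ 2 ∂(cyl d T) =
      ∫ p, Real.exp (-lam * p.1) * z p ^ 2 ∂(cyl d T) := by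
  rw [integral_prod _ (integrable_exp_mul_cyl hl (integrable_norm_sq_spatialFourier hz hz2)),
    integral_prod _ (integrable_exp_mul_cyl hl hz2)]
  refine integral_congr_ae ?_
  filter_upwards [ae_integral_norm_sq_spatialFourier hz hz2] with t ht
  rw [integral_const_mul, integral_const_mul, ht.2]

/-- Polarization, by which Parseval's identity for w and z reduces to Plancherel for w + z and w -
z. -/
theorem re_mul_conj_eq (a b : ℂ) :
    (a * (starRingEnd ℂ) b).re = (‖a + b‖ ^ 2 - ‖a - b‖ ^ 2) / 4 := by
  simp only [← Complex.normSq_eq_norm_sq, Complex.normSq_apply, Complex.mul_re, Complex.conj_re,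
    Complex.conj_im, Complex.add_re, Complex.add_im, Complex.sub_re, Complex.sub_im]
  ring

theorem integrable_sq_add_and_sub {z w : ℝ × E d → ℝ}
    (hz : Integrable z (cyl d T)) (hw : Integrable w (cyl d T))
    (hz2 : Integrable (fun p => z p ^ 2) (cyl d T))
    (hw2 : Integrable (fun p => w p ^ 2) (cyl d T)) :
    Integrable (fun p => (w + z) p ^ 2) (cyl d T) ∧
      Integrable (fun p => (w - z) p ^ 2) (cyl d T) := by
  have hz3 := (memLp_two_iff_integrable_sq hz.1).2 hz2
  have hw3 := (memLp_two_iff_integrable_sq hw.1).2 hw2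
  exact ⟨(memLp_two_iff_integrable_sq (hw.add hz).1).1 (hw3.add hz3),
    (memLp_two_iff_integrable_sq (hw.sub hz).1).1 (hw3.sub hz3)⟩

theorem ae_re_mul_conj_spatialFourier {z w : ℝ × E d → ℝ}
    (hz : Integrable z (cyl d T)) (hw : Integrable w (cyl d T)) :
    ∀ᵐ p ∂(cyl d T), (spatialFourier w p * (starRingEnd ℂ) (spatialFourier z p)).re =
      (‖spatialFourier (w + z) p‖ ^ 2 - ‖spatialFourier (w - z) p‖ ^ 2) / 4 := by
  have h : ∀ᵐ p ∂(cyl d T), Integrable (fun x => z (p.1, x)) ∧ Integrable (fun x => w (p.1, x)) :=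
    Measure.quasiMeasurePreserving_fst.ae (hz.prod_right_ae.and hw.prod_right_ae)
  filter_upwards [h] with p hp
  rw [spatialFourier_add hp.2 hp.1, spatialFourier_sub hp.2 hp.1, re_mul_conj_eq]

/-- Parseval's identity on the cylinder with a weight in time. -/
theorem integral_exp_mul_re_spatialFourier {lam : ℝ} (hl : 0 ≤ lam) {z w : ℝ × E d → ℝ}
    (hz : Integrable z (cyl d T)) (hw : Integrable w (cyl d T))
    (hz2 : Integrable (fun p => z p ^ 2) (cyl d T))
    (hw2 : Integrable (fun p => w p ^ 2) (cyl d T)) :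
    Integrable (fun p => (spatialFourier w p * (starRingEnd ℂ) (spatialFourier z p)).re)
      (cyl d T) ∧
    ∫ p, Real.exp (-lam * p.1) * (spatialFourier w p * (starRingEnd ℂ) (spatialFourier z p)).re
      ∂(cyl d T) = ∫ p, Real.exp (-lam * p.1) * (w p * z p) ∂(cyl d T) := by
  obtain ⟨ha, hs⟩ := integrable_sq_add_and_sub hz hw hz2 hw2
  have hae := ae_re_mul_conj_spatialFourier hz hw
  have hFa := integrable_norm_sq_spatialFourier (hw.add hz) ha
  have hFs := integrable_norm_sq_spatialFourier (hw.sub hz) hs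
  refine ⟨((hFa.sub hFs).div_const 4).congr ?_, ?_⟩
  · filter_upwards [hae] with p hp using hp.symm
  · have h1 := integral_exp_mul_norm_sq_spatialFourier hl (hw.add hz) ha
    have h2 := integral_exp_mul_norm_sq_spatialFourier hl (hw.sub hz) hs
    calc _ = ∫ p, (Real.exp (-lam * p.1) * ‖spatialFourier (w + z) p‖ ^ 2 -
          Real.exp (-lam * p.1) * ‖spatialFourier (w - z) p‖ ^ 2) / 4 ∂(cyl d T) := by
          refine integral_congr_ae ?_
          filter_upwards [hae] with p hp
          rw [hp]; ring
      _ = ∫ p, (Real.exp (-lam * p.1) * (w + z) p ^ 2 -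
          Real.exp (-lam * p.1) * (w - z) p ^ 2) / 4 ∂(cyl d T) := by
          rw [integral_div, integral_div, integral_sub (integrable_exp_mul_cyl hl hFa)
            (integrable_exp_mul_cyl hl hFs), integral_sub (integrable_exp_mul_cyl hl ha)
            (integrable_exp_mul_cyl hl hs), h1, h2]
      _ = _ := by
          congr 1; ext p
          simp only [Pi.add_apply, Pi.sub_apply]; ring

end SpatialFourier

/-! ### The energy estimate in the regularized negative-order norm -/

section EnergyEstimate

variable {d : ℕ} {T : ℝ}

/-- The Fourier transform in space of `p ↦ ⟨q p, ξ⟩`, evaluated at `ξ`. -/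
noncomputable def fluxFourier (q : ℝ × E d → E d) (p : ℝ × E d) : ℂ :=
  ∑ j, (p.2 j : ℂ) * spatialFourier (fun r => q r j) p

/-- The sum of the squared absolute values of the Fourier transforms of the components of `q`. -/
noncomputable def fluxSq (q : ℝ × E d → E d) (p : ℝ × E d) : ℝ :=
  ∑ j, ‖spatialFourier (fun r => q r j) p‖ ^ 2

theorem fluxSq_nonneg (q : ℝ × E d → E d) (p : ℝ × E d) : 0 ≤ fluxSq q p :=
  Finset.sum_nonneg fun _ _ => by positivity

theorem norm_sq_fluxFourier_le (q : ℝ × E d → E d) (p : ℝ × E d) :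
    ‖fluxFourier q p‖ ^ 2 ≤ ‖p.2‖ ^ 2 * fluxSq q p := by
  have h1 : ‖fluxFourier q p‖ ≤ ∑ j, |p.2 j| * ‖spatialFourier (fun r => q r j) p‖ := by
    refine (norm_sum_le _ _).trans (le_of_eq ?_)
    congr 1; ext j
    rw [norm_mul, Complex.norm_real, Real.norm_eq_abs]
  calc _ ≤ (∑ j, |p.2 j| * ‖spatialFourier (fun r => q r j) p‖) ^ 2 :=
        pow_le_pow_left₀ (norm_nonneg _) h1 2
    _ ≤ (∑ j, |p.2 j| ^ 2) * ∑ j, ‖spatialFourier (fun r => q r j) p‖ ^ 2 :=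
        Finset.sum_mul_sq_le_sq_mul_sq _ _ _
    _ = _ := by
        rw [EuclideanSpace.real_norm_sq_eq, fluxSq]
        simp only [sq_abs]

theorem integrable_apply {α : Type*} [MeasurableSpace α] {μ : Measure α} {q : α → E d}
    (hq : Integrable q μ) (j : Fin d) : Integrable (fun r => q r j) μ :=
  (EuclideanSpace.proj (𝕜 := ℝ) j).integrable_comp hq

theorem norm_apply_le (v : E d) (j : Fin d) : |v j| ≤ ‖v‖ := PiLp.norm_apply_le v j

theorem integrable_sq_apply {q : ℝ × E d → E d} (hq : Integrable q (cyl d T))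
    (hq2 : Integrable (fun p => ‖q p‖ ^ 2) (cyl d T)) (j : Fin d) :
    Integrable (fun r => q r j ^ 2) (cyl d T) := by
  refine hq2.mono' ((integrable_apply hq j).1.pow 2) (ae_of_all _ fun p => ?_)
  rw [Real.norm_of_nonneg (sq_nonneg _), ← sq_abs]
  exact pow_le_pow_left₀ (abs_nonneg _) (norm_apply_le _ j) 2

theorem integrable_fluxSq_and_integral_eq {lam : ℝ} (hl : 0 ≤ lam) {q : ℝ × E d → E d}
    (hq : Integrable q (cyl d T)) (hq2 : Integrable (fun p => ‖q p‖ ^ 2) (cyl d T)) :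
    Integrable (fluxSq q) (cyl d T) ∧
    ∫ p, Real.exp (-lam * p.1) * fluxSq q p ∂(cyl d T) =
      ∫ p, Real.exp (-lam * p.1) * ‖q p‖ ^ 2 ∂(cyl d T) := by
  have h1 : ∀ j, Integrable (fun p => ‖spatialFourier (fun r => q r j) p‖ ^ 2) (cyl d T) :=
    fun j => integrable_norm_sq_spatialFourier (integrable_apply hq j) (integrable_sq_apply hq hq2 j)
  refine ⟨integrable_finsetSum _ fun j _ => h1 j, ?_⟩
  simp only [fluxSq, EuclideanSpace.real_norm_sq_eq, Finset.mul_sum]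
  rw [integral_finsetSum _ fun j _ => integrable_exp_mul_cyl hl (h1 j),
    integral_finsetSum _ fun j _ => integrable_exp_mul_cyl hl (integrable_sq_apply hq hq2 j)]
  congr 1; ext j
  exact integral_exp_mul_norm_sq_spatialFourier hl (integrable_apply hq j)
    (integrable_sq_apply hq hq2 j)

/-- For almost every t the slice q(t, ·) vanishes almost everywhere, so its transform vanishes at
every frequency. Used in place of the symbol bound when there is no drift. -/
theorem fluxSq_ae_eq_zero {q : ℝ × E d → E d} (hq : q =ᵐ[cyl d T] 0) :
    fluxSq q =ᵐ[cyl d T] 0 := by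
  have h1 : ∀ᵐ t ∂volume.restrict (Ioo 0 T), ∀ᵐ x, q (t, x) = 0 := Measure.ae_ae_of_ae_prod hq
  have h2 : ∀ᵐ p ∂(cyl d T), ∀ᵐ x, q (p.1, x) = 0 := Measure.quasiMeasurePreserving_fst.ae h1
  filter_upwards [h2] with p hp
  refine Finset.sum_eq_zero fun j _ => ?_
  have : spatialFourier (fun r => q r j) p = 0 := by
    rw [spatialFourier_eq_integral]
    refine integral_eq_zero_of_ae ?_
    filter_upwards [hp] with x hx
    simp [hx]
  simp [this]

/-- Differentiation shifts the phase by π/2. The flux tested with phases 0 and π/2 therefore yields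
the imaginary part and minus the real part of `fluxFourier`, up to the factor 2π. -/
theorem fderiv_planeWave_eq_planeWave (ξ : E d) (a : ℝ) (x h : E d) :
    fderiv ℝ (planeWave ξ a) x h =
      2 * Real.pi * ∑ j, ξ j * (h j * planeWave ξ (a + Real.pi / 2) x) := by
  have hin : inner ℝ h ξ = ∑ j, ξ j * h j := by
    simp only [PiLp.inner_apply, RCLike.inner_apply, conj_trivial]
  rw [fderiv_planeWave_apply, planeWave, ← add_assoc, Real.cos_add_pi_div_two, hin]
  simp only [← mul_assoc, ← Finset.sum_mul]
  ring

theorem integrable_mul_planeWave {f : E d → ℝ} (hf : Integrable f) (ξ : E d) (a : ℝ) :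
    Integrable (fun x => f x * planeWave ξ a x) :=
  hf.mul_bdd (c := 1) (contDiff_planeWave ξ a).continuous.aestronglyMeasurable
    (ae_of_all _ fun x => abs_planeWave_le_one ξ a x)

theorem integral_fderiv_planeWave {q : E d → E d} (hq : Integrable q) (ξ : E d) (a : ℝ) :
    ∫ x, fderiv ℝ (planeWave ξ a) x (q x) =
      2 * Real.pi * ∑ j, ξ j * ∫ x, q x j * planeWave ξ (a + Real.pi / 2) x := by
  simp only [fderiv_planeWave_eq_planeWave]
  rw [integral_const_mul, integral_finsetSum]
  · simp only [integral_const_mul]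
  · exact fun j _ => (integrable_mul_planeWave (integrable_apply hq j) _ _).const_mul _

theorem planeWave_pi_div_two_add (ξ : E d) (x : E d) :
    planeWave ξ (Real.pi / 2 + Real.pi / 2) x = -planeWave ξ 0 x := by
  rw [planeWave, planeWave, add_halves, Real.cos_add_pi, add_zero]

theorem im_fluxFourier {q : ℝ × E d → E d} {p : ℝ × E d} (hq : Integrable fun x => q (p.1, x)) :
    2 * Real.pi * (fluxFourier q p).im = ∫ x, fderiv ℝ (planeWave p.2 0) x (q (p.1, x)) := by
  rw [integral_fderiv_planeWave hq, fluxFourier, Complex.im_sum, zero_add]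
  congr 2; ext j
  rw [Complex.im_ofReal_mul, spatialFourier_im (integrable_apply hq j)]

theorem re_fluxFourier {q : ℝ × E d → E d} {p : ℝ × E d} (hq : Integrable fun x => q (p.1, x)) :
    -(2 * Real.pi * (fluxFourier q p).re) =
      ∫ x, fderiv ℝ (planeWave p.2 (Real.pi / 2)) x (q (p.1, x)) := by
  rw [integral_fderiv_planeWave hq, fluxFourier, Complex.re_sum, ← mul_neg, ← Finset.sum_neg_distrib]
  congr 2; ext j
  simp only [planeWave_pi_div_two_add, mul_neg, integral_neg]
  rw [Complex.re_ofReal_mul, spatialFourier_re (integrable_apply hq j)]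

/-- The right-hand side of the energy identity for the equation with symbol `m`. -/
noncomputable def energyRate (m : E d → ℝ) (z w : ℝ × E d → ℝ) (q : ℝ × E d → E d)
    (p : ℝ × E d) : ℝ :=
  -2 * m p.2 * (spatialFourier w p * (starRingEnd ℂ) (spatialFourier z p)).re +
    4 * Real.pi * (fluxFourier q p * (starRingEnd ℂ) (spatialFourier z p)).im

variable {z w : ℝ × E d → ℝ} {q : ℝ × E d → E d} {m : E d → ℝ}

theorem integrable_flux (hw : Integrable w (cyl d T)) (hq : Integrable q (cyl d T)) (ξ : E d)
    (a c : ℝ) : Integrable (fun p : ℝ × E d => -(w p * (planeWave ξ a p.2 * c)) +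
      fderiv ℝ (planeWave ξ a) p.2 (q p)) (cyl d T) := by
  have hpc : Continuous (planeWave ξ a) := (contDiff_planeWave ξ a).continuous
  have hfc : Continuous (fderiv ℝ (planeWave ξ a)) :=
    (contDiff_planeWave ξ a).continuous_fderiv (by simp)
  refine Integrable.add (Integrable.neg ?_) ?_
  · refine hw.mul_bdd (c := |c|) (Continuous.aestronglyMeasurable (by fun_prop))
      (ae_of_all _ fun p => ?_)
    rw [norm_mul]
    exact mul_le_of_le_one_left (abs_nonneg _) (abs_planeWave_le_one ξ a p.2)
  · refine (hq.norm.const_mul (2 * Real.pi * ‖ξ‖)).mono'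
      (isBoundedBilinearMap_apply.continuous.comp_aestronglyMeasurable
        ((hfc.comp continuous_snd).aestronglyMeasurable.prodMk hq.1)) (ae_of_all _ fun p => ?_)
    exact (ContinuousLinearMap.le_opNorm _ _).trans
      (mul_le_mul_of_nonneg_right (norm_fderiv_planeWave_le ξ a p.2) (norm_nonneg _))

/-- The energy inequality at a fixed frequency. -/
theorem energy_inequality_frequency (hT : 0 < T) (hz : Integrable z (cyl d T))
    (hw : Integrable w (cyl d T)) (hq : Integrable q (cyl d T))
    (hid : ∀ (ξ : E d) (a : ℝ), ∀ᵐ t ∂volume.restrict (Ioo 0 T),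
      ∫ x, z (t, x) * planeWave ξ a x =
      ∫ p, (-(w p * (planeWave ξ a p.2 * m ξ)) + fderiv ℝ (planeWave ξ a) p.2 (q p)) ∂(cyl d t))
    (lam : ℝ) (ξ : E d) :
    IntegrableOn (fun t => Real.exp (-lam * t) * energyRate m z w q (t, ξ)) (Ioo 0 T) ∧
    lam * ∫ t in Ioo 0 T, Real.exp (-lam * t) * ‖spatialFourier z (t, ξ)‖ ^ 2 ≤
      ∫ t in Ioo 0 T, Real.exp (-lam * t) * energyRate m z w q (t, ξ) := by
  set g : ℝ → ℝ → ℝ := fun a s => ∫ x, (-(w (s, x) * (planeWave ξ a x * m ξ)) +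
      fderiv ℝ (planeWave ξ a) x (q (s, x))) with hg
  have hgi : ∀ a, IntegrableOn (g a) (Ioo 0 T) := fun a =>
    (integrable_flux hw hq ξ a (m ξ)).integral_prod_left
  have hZ : ∀ a, ∀ᵐ t ∂volume.restrict (Ioo 0 T),
      ∫ x, z (t, x) * planeWave ξ a x = ∫ s in (0 : ℝ)..t, g a s := fun a => by
    filter_upwards [hid ξ a, ae_restrict_mem measurableSet_Ioo] with t ht htT
    rw [ht, integral_cyl_eq_intervalIntegral htT.1.le
      ((integrable_flux hw hq ξ a (m ξ)).mono_measure (cyl_mono htT.2.le))]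
  have hgw : ∀ a, ∀ᵐ s ∂volume.restrict (Ioo 0 T), g a s =
      -(m ξ * ∫ x, w (s, x) * planeWave ξ a x) +
        ∫ x, fderiv ℝ (planeWave ξ a) x (q (s, x)) := fun a => by
    filter_upwards [hw.prod_right_ae, hq.prod_right_ae,
      (integrable_flux hw hq ξ a 0).prod_right_ae] with s h1 h2 h3
    simp only [mul_zero, neg_zero, zero_add] at h3
    have h4 : ∀ x, -(w (s, x) * (planeWave ξ a x * m ξ)) = -m ξ * (w (s, x) * planeWave ξ a x) :=
      fun x => by ring
    simp only [hg, h4]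
    rw [integral_add ((integrable_mul_planeWave h1 ξ a).const_mul _) h3, integral_const_mul,
      neg_mul]
  -- Phases 0 and π/2 give the real and imaginary parts of ẑ(·, ξ). The sum of the two scalar
  -- inequalities is the one for |ẑ|².
  obtain ⟨ha0, hb0, hc0⟩ := weighted_energy_le hT (hgi 0) lam
  obtain ⟨ha1, hb1, hc1⟩ := weighted_energy_le hT (hgi (Real.pi / 2)) lam
  have hsq : ∀ᵐ t ∂volume.restrict (Ioo 0 T),
      Real.exp (-lam * t) * (∫ s in (0 : ℝ)..t, g 0 s) ^ 2 +
        Real.exp (-lam * t) * (∫ s in (0 : ℝ)..t, g (Real.pi / 2) s) ^ 2 =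
      Real.exp (-lam * t) * ‖spatialFourier z (t, ξ)‖ ^ 2 := by
    filter_upwards [hZ 0, hZ (Real.pi / 2), hz.prod_right_ae] with t h0 h1 hzt
    rw [← h0, ← h1, ← Complex.normSq_eq_norm_sq, Complex.normSq_apply,
      spatialFourier_re (p := (t, ξ)) hzt, spatialFourier_im (p := (t, ξ)) hzt]
    ring
  have hrate : ∀ᵐ t ∂volume.restrict (Ioo 0 T),
      Real.exp (-lam * t) * (2 * g 0 t * ∫ s in (0 : ℝ)..t, g 0 s) +
        Real.exp (-lam * t) * (2 * g (Real.pi / 2) t * ∫ s in (0 : ℝ)..t, g (Real.pi / 2) s) =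
      Real.exp (-lam * t) * energyRate m z w q (t, ξ) := by
    filter_upwards [hZ 0, hZ (Real.pi / 2), hz.prod_right_ae, hw.prod_right_ae, hq.prod_right_ae,
      hgw 0, hgw (Real.pi / 2)] with t h0 h1 hzt hwt hqt h2 h3
    rw [← h0, ← h1, h2, h3, energyRate, ← im_fluxFourier (p := (t, ξ)) hqt,
      ← re_fluxFourier (p := (t, ξ)) hqt,
      ← spatialFourier_re (p := (t, ξ)) hzt, ← spatialFourier_im (p := (t, ξ)) hzt,
      ← spatialFourier_re (p := (t, ξ)) hwt, ← spatialFourier_im (p := (t, ξ)) hwt]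
    simp only [Complex.mul_re, Complex.mul_im, Complex.conj_re, Complex.conj_im]
    ring
  refine ⟨(hb0.add hb1).congr hrate, ?_⟩
  rw [← integral_congr_ae hsq, ← integral_congr_ae hrate, integral_add ha0 ha1,
    integral_add hb0 hb1, mul_add]
  exact add_le_add hc0 hc1

/-- Pointwise absorption estimate for the energy rate. -/
theorem energyRate_div_le {ε δ K A : ℝ} (hε : 0 < ε) (hδ : 0 ≤ δ) (hK : 0 ≤ K) (hA : 0 ≤ A)
    {p : ℝ × E d} (hm : 0 ≤ m p.2)
    (hsymb : (2 * Real.pi * ‖p.2‖) ^ 2 * fluxSq q p ≤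
      δ * (K * m p.2 + A * m p.2 ^ 2) * fluxSq q p) :
    energyRate m z w q p / (ε + m p.2) ≤
      -2 * (spatialFourier w p * (starRingEnd ℂ) (spatialFourier z p)).re +
        (1 + K) * (‖spatialFourier z p‖ ^ 2 / (ε + m p.2)) + ε * ‖spatialFourier w p‖ ^ 2 +
        δ * fluxSq q p + A * ‖spatialFourier z p‖ ^ 2 := by
  have hc : (spatialFourier w p * (starRingEnd ℂ) (spatialFourier z p)).re ≤
      ‖spatialFourier w p‖ * ‖spatialFourier z p‖ := by
    refine (Complex.re_le_norm _).trans_eq ?_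
    rw [norm_mul, Complex.norm_conj]
  have hP : (fluxFourier q p * (starRingEnd ℂ) (spatialFourier z p)).im ≤
      ‖fluxFourier q p‖ * ‖spatialFourier z p‖ := by
    refine (Complex.im_le_norm _).trans_eq ?_
    rw [norm_mul, Complex.norm_conj]
  have hPQ := norm_sq_fluxFourier_le q p
  have hQ := fluxSq_nonneg q p
  unfold energyRate
  generalize (spatialFourier w p * (starRingEnd ℂ) (spatialFourier z p)).re = c at *
  generalize (fluxFourier q p * (starRingEnd ℂ) (spatialFourier z p)).im = X at *
  generalize hPn : ‖fluxFourier q p‖ = P at *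
  generalize hzn : ‖spatialFourier z p‖ = zz at *
  generalize hwn : ‖spatialFourier w p‖ = ww at *
  generalize fluxSq q p = Q at *
  generalize hρ : ‖p.2‖ = ρ at *
  generalize m p.2 = μ at *
  have hP0 : 0 ≤ P := hPn ▸ norm_nonneg _
  have hz0 : 0 ≤ zz := hzn ▸ norm_nonneg _
  have hs : 0 < ε + μ := by linarith
  -- The remainder in -2μ/(ε + μ) = -2 + 2ε/(ε + μ). Young's inequality gives ε²|ŵ|²/(ε + μ), and
  -- ε/(ε + μ) ≤ 1.
  have h1 : 2 * ε * c / (ε + μ) ≤ zz ^ 2 / (ε + μ) + ε * ww ^ 2 := by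
    rw [div_add' _ _ _ hs.ne']
    refine div_le_div_of_nonneg_right ?_ hs.le
    have : 0 ≤ ε * ww ^ 2 * μ := by positivity
    nlinarith [sq_nonneg (zz - ε * ww), mul_le_mul_of_nonneg_left hc hε.le]
  -- Arithmetic–geometric mean in squared form: the square of the left side is at most 4ab ≤ (a +
  -- b)², where a = δQ and b is the bracket. The symbol bound enters here, with μ enlarged to ε + μ.
  have h2 : 4 * Real.pi * X / (ε + μ) ≤ δ * Q + (K * (zz ^ 2 / (ε + μ)) + A * zz ^ 2) := by
    have h3 : 4 * Real.pi * X / (ε + μ) ≤ 4 * Real.pi * (P * zz) / (ε + μ) := by gcongr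
    refine h3.trans ?_
    refine le_of_abs_le (abs_le_of_sq_le_sq ?_ (by positivity))
    have h4 : (4 * Real.pi * (P * zz) / (ε + μ)) ^ 2 ≤
        4 * (δ * Q) * (K * (zz ^ 2 / (ε + μ)) + A * zz ^ 2) := by
      have h5 : (2 * Real.pi) ^ 2 * P ^ 2 ≤ δ * (K * μ + A * μ ^ 2) * Q := by
        refine le_trans ?_ hsymb
        calc _ ≤ (2 * Real.pi) ^ 2 * (ρ ^ 2 * Q) := by gcongr
          _ = _ := by ring
      have h6 : K * μ + A * μ ^ 2 ≤ (K / (ε + μ) + A) * (ε + μ) ^ 2 := by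
        have : (K / (ε + μ) + A) * (ε + μ) ^ 2 = K * (ε + μ) + A * (ε + μ) ^ 2 := by field_simp
        rw [this]
        gcongr <;> linarith
      rw [div_pow, div_le_iff₀ (by positivity)]
      calc _ = 4 * zz ^ 2 * ((2 * Real.pi) ^ 2 * P ^ 2) := by ring
        _ ≤ 4 * zz ^ 2 * (δ * (K * μ + A * μ ^ 2) * Q) := by gcongr
        _ ≤ 4 * zz ^ 2 * (δ * ((K / (ε + μ) + A) * (ε + μ) ^ 2) * Q) := by gcongr
        _ = _ := by ring
    refine h4.trans ?_
    nlinarith [sq_nonneg (δ * Q - (K * (zz ^ 2 / (ε + μ)) + A * zz ^ 2))]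
  have h7 : (-2 * μ * c + 4 * Real.pi * X) / (ε + μ) =
      -2 * c + 2 * ε * c / (ε + μ) + 4 * Real.pi * X / (ε + μ) := by
    field_simp; ring
  rw [h7]
  linarith

theorem integral_add_const_mul {α : Type*} [MeasurableSpace α] {μ : Measure α} {f g : α → ℝ}
    (hf : Integrable f μ) (hg : Integrable g μ) (c : ℝ) :
    Integrable (fun x => f x + c * g x) μ ∧ ∫ x, f x + c * g x ∂μ = ∫ x, f x ∂μ + c * ∫ x, g x ∂μ :=
  ⟨hf.add (hg.const_mul c), by rw [integral_add hf (hg.const_mul c), integral_const_mul]⟩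

/-- The uniform energy bound for the regularized negative-order norm. -/
theorem integral_regularized_energy_le (hT : 0 < T) (hz : Integrable z (cyl d T))
    (hw : Integrable w (cyl d T)) (hq : Integrable q (cyl d T))
    (hz2 : Integrable (fun p => z p ^ 2) (cyl d T))
    (hw2 : Integrable (fun p => w p ^ 2) (cyl d T))
    (hq2 : Integrable (fun p => ‖q p‖ ^ 2) (cyl d T))
    (hid : ∀ (ξ : E d) (a : ℝ), ∀ᵐ t ∂volume.restrict (Ioo 0 T),
      ∫ x, z (t, x) * planeWave ξ a x =
      ∫ p, (-(w p * (planeWave ξ a p.2 * m ξ)) + fderiv ℝ (planeWave ξ a) p.2 (q p)) ∂(cyl d t))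
    (hm : ∀ ξ, 0 ≤ m ξ) (hmm : Measurable m) {δ K A : ℝ} (hδ : 0 ≤ δ) (hK : 0 ≤ K) (hA : 0 ≤ A)
    (hsymb : (∀ ξ, (2 * Real.pi * ‖ξ‖) ^ 2 ≤ δ * (K * m ξ + A * m ξ ^ 2)) ∨ q =ᵐ[cyl d T] 0)
    (hdiss : ∀ᵐ p ∂(cyl d T), -2 * (w p * z p) + δ * ‖q p‖ ^ 2 + A * z p ^ 2 ≤ 0)
    {ε : ℝ} (hε : 0 < ε) :
    Integrable (fun p => ‖spatialFourier z p‖ ^ 2 / (ε + m p.2)) (cyl d T) ∧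
    ∫ p, Real.exp (-(2 + K) * p.1) * (‖spatialFourier z p‖ ^ 2 / (ε + m p.2)) ∂(cyl d T) ≤
      ε * ∫ p, Real.exp (-(2 + K) * p.1) * w p ^ 2 ∂(cyl d T) := by
  -- One more than the coefficient 1 + K of the energy in the pointwise bound, so exactly one copy
  -- of the energy survives the absorption.
  set lam := 2 + K with hlam
  have hl : 0 ≤ lam := by positivity
  have hs : ∀ ξ, 0 < ε + m ξ := fun ξ => by linarith [hm ξ]
  have hFz := integrable_norm_sq_spatialFourier hz hz2
  have hFw := integrable_norm_sq_spatialFourier hw hw2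
  obtain ⟨hQ, hQeq⟩ := integrable_fluxSq_and_integral_eq hl hq hq2
  obtain ⟨hR, hReq⟩ := integral_exp_mul_re_spatialFourier hl hz hw hz2 hw2
  have hJ : Integrable (fun p => ‖spatialFourier z p‖ ^ 2 / (ε + m p.2)) (cyl d T) := by
    simp only [div_eq_mul_inv]
    refine hFz.mul_bdd (c := ε⁻¹) ((measurable_const.add
      (hmm.comp measurable_snd)).inv.aestronglyMeasurable) (ae_of_all _ fun p => ?_)
    rw [norm_inv, Real.norm_of_nonneg (hs _).le]
    exact inv_anti₀ hε (by linarith [hm p.2])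
  refine ⟨hJ, ?_⟩
  have hsymb' : ∀ᵐ p ∂(cyl d T), (2 * Real.pi * ‖p.2‖) ^ 2 * fluxSq q p ≤
      δ * (K * m p.2 + A * m p.2 ^ 2) * fluxSq q p := by
    rcases hsymb with h | h
    · exact ae_of_all _ fun p => mul_le_mul_of_nonneg_right (h p.2) (fluxSq_nonneg q p)
    · filter_upwards [fluxSq_ae_eq_zero h] with p hp
      simp [hp]
  set U : ℝ × E d → ℝ := fun p =>
      -2 * (spatialFourier w p * (starRingEnd ℂ) (spatialFourier z p)).re +
        (1 + K) * (‖spatialFourier z p‖ ^ 2 / (ε + m p.2)) + ε * ‖spatialFourier w p‖ ^ 2 +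
        δ * fluxSq q p + A * ‖spatialFourier z p‖ ^ 2 with hU
  have hUi : Integrable U (cyl d T) :=
    ((((hR.const_mul (-2)).add (hJ.const_mul (1 + K))).add (hFw.const_mul ε)).add
      (hQ.const_mul δ)).add (hFz.const_mul A)
  have hUe := integrable_exp_mul_cyl hl hUi
  have hJe := integrable_exp_mul_cyl hl hJ
  have hUle : ∀ᵐ p ∂(cyl d T), energyRate m z w q p / (ε + m p.2) ≤ U p := by
    filter_upwards [hsymb'] with p hp
    exact energyRate_div_le hε hδ hK hA (hm p.2) hp
  -- The order of the variables is swapped because the energy inequality is an integrated statement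
  -- in t at fixed ξ.
  have hUle' : ∀ᵐ ξ : E d, ∀ᵐ t ∂volume.restrict (Ioo 0 T),
      energyRate m z w q (t, ξ) / (ε + m ξ) ≤ U (t, ξ) :=
    Measure.ae_ae_of_ae_prod (Measure.measurePreserving_swap.quasiMeasurePreserving.ae hUle)
  have hmain : lam * ∫ p, Real.exp (-lam * p.1) * (‖spatialFourier z p‖ ^ 2 / (ε + m p.2))
      ∂(cyl d T) ≤ ∫ p, Real.exp (-lam * p.1) * U p ∂(cyl d T) := by
    rw [integral_prod_symm _ hJe, integral_prod_symm _ hUe, ← integral_const_mul]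
    refine integral_mono_ae (hJe.integral_prod_right.const_mul lam) hUe.integral_prod_right ?_
    filter_upwards [hUle', hUe.prod_left_ae] with ξ h1 h2
    obtain ⟨h3, h4⟩ := energy_inequality_frequency hT hz hw hq hid lam ξ
    calc lam * ∫ t in Ioo 0 T, Real.exp (-lam * t) * (‖spatialFourier z (t, ξ)‖ ^ 2 / (ε + m ξ))
        = (lam * ∫ t in Ioo 0 T, Real.exp (-lam * t) * ‖spatialFourier z (t, ξ)‖ ^ 2) /
            (ε + m ξ) := by
          simp only [← mul_div_assoc]
          rw [integral_div, mul_div_assoc]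
      _ ≤ (∫ t in Ioo 0 T, Real.exp (-lam * t) * energyRate m z w q (t, ξ)) / (ε + m ξ) :=
          div_le_div_of_nonneg_right h4 (hs ξ).le
      _ = ∫ t in Ioo 0 T, Real.exp (-lam * t) * energyRate m z w q (t, ξ) / (ε + m ξ) :=
          (integral_div _ _).symm
      _ ≤ ∫ t in Ioo 0 T, Real.exp (-lam * t) * U (t, ξ) := by
          refine integral_mono_ae (Integrable.div_const h3 _) h2 ?_
          filter_upwards [h1] with t ht
          rw [mul_div_assoc]
          exact mul_le_mul_of_nonneg_left ht (Real.exp_nonneg _)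
  -- Plancherel and Parseval carry the terms without the factor 1/(ε + m) back to physical space,
  -- where the dissipation inequality holds pointwise.
  have hUint : ∫ p, Real.exp (-lam * p.1) * U p ∂(cyl d T) =
      (∫ p, Real.exp (-lam * p.1) *
        (-2 * (w p * z p) + δ * ‖q p‖ ^ 2 + A * z p ^ 2) ∂(cyl d T)) +
      (1 + K) * (∫ p, Real.exp (-lam * p.1) * (‖spatialFourier z p‖ ^ 2 / (ε + m p.2))
        ∂(cyl d T)) + ε * ∫ p, Real.exp (-lam * p.1) * w p ^ 2 ∂(cyl d T) := by
    have e1 := integrable_exp_mul_cyl hl hR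
    have e2 := integrable_exp_mul_cyl hl hFw
    have e3 := integrable_exp_mul_cyl hl hQ
    have e4 := integrable_exp_mul_cyl hl hFz
    have hwz : Integrable (fun p => w p * z p) (cyl d T) :=
      ((memLp_two_iff_integrable_sq hw.1).2 hw2).integrable_mul
        ((memLp_two_iff_integrable_sq hz.1).2 hz2)
    have f1 := integrable_exp_mul_cyl hl hwz
    have f3 := integrable_exp_mul_cyl hl hq2
    have f4 := integrable_exp_mul_cyl hl hz2
    have s1 : ∀ p, Real.exp (-lam * p.1) * U p =
        -2 * (Real.exp (-lam * p.1) *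
          (spatialFourier w p * (starRingEnd ℂ) (spatialFourier z p)).re) +
        (1 + K) * (Real.exp (-lam * p.1) * (‖spatialFourier z p‖ ^ 2 / (ε + m p.2))) +
        ε * (Real.exp (-lam * p.1) * ‖spatialFourier w p‖ ^ 2) +
        δ * (Real.exp (-lam * p.1) * fluxSq q p) +
        A * (Real.exp (-lam * p.1) * ‖spatialFourier z p‖ ^ 2) := fun p => by
      simp only [hU]; ring
    have s2 : ∀ p, Real.exp (-lam * p.1) *
        (-2 * (w p * z p) + δ * ‖q p‖ ^ 2 + A * z p ^ 2) =
        -2 * (Real.exp (-lam * p.1) * (w p * z p)) + δ * (Real.exp (-lam * p.1) * ‖q p‖ ^ 2) +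
        A * (Real.exp (-lam * p.1) * z p ^ 2) := fun p => by ring
    simp only [s1, s2]
    obtain ⟨i2, E2⟩ := integral_add_const_mul (e1.const_mul (-2)) hJe (1 + K)
    obtain ⟨i3, E3⟩ := integral_add_const_mul i2 e2 ε
    obtain ⟨i4, E4⟩ := integral_add_const_mul i3 e3 δ
    obtain ⟨-, E5⟩ := integral_add_const_mul i4 e4 A
    obtain ⟨j2, G2⟩ := integral_add_const_mul (f1.const_mul (-2)) f3 δ
    obtain ⟨-, G3⟩ := integral_add_const_mul j2 f4 A
    rw [E5, E4, E3, E2, G3, G2, integral_const_mul, integral_const_mul, hReq, hQeq, integral_exp_mul_norm_sq_spatialFourier hl hz hz2,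
      integral_exp_mul_norm_sq_spatialFourier hl hw hw2]
    ring
  have hneg : ∫ p, Real.exp (-lam * p.1) *
        (-2 * (w p * z p) + δ * ‖q p‖ ^ 2 + A * z p ^ 2) ∂(cyl d T) ≤ 0 := by
    refine integral_nonpos_of_ae ?_
    filter_upwards [hdiss] with p hp
    exact mul_nonpos_of_nonneg_of_nonpos (Real.exp_nonneg _) hp
  rw [hUint] at hmain
  have : lam = 1 + (1 + K) := by rw [hlam]; ring
  nlinarith

end EnergyEstimate

/-! ### Vanishing of the difference and choice of constants -/

section Uniqueness

variable {d : ℕ} {T : ℝ} {z w : ℝ × E d → ℝ} {q : ℝ × E d → E d} {m : E d → ℝ}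

/-- A solution of the linear problem with zero initial datum and a dissipation inequality
vanishes. -/
theorem ae_eq_zero_of_energy_le (hT : 0 < T) (hz : Integrable z (cyl d T))
    (hw : Integrable w (cyl d T)) (hq : Integrable q (cyl d T))
    (hz2 : Integrable (fun p => z p ^ 2) (cyl d T))
    (hw2 : Integrable (fun p => w p ^ 2) (cyl d T))
    (hq2 : Integrable (fun p => ‖q p‖ ^ 2) (cyl d T))
    (hid : ∀ (ξ : E d) (a : ℝ), ∀ᵐ t ∂volume.restrict (Ioo 0 T),
      ∫ x, z (t, x) * planeWave ξ a x =
      ∫ p, (-(w p * (planeWave ξ a p.2 * m ξ)) + fderiv ℝ (planeWave ξ a) p.2 (q p)) ∂(cyl d t))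
    (hm : ∀ ξ, 0 ≤ m ξ) (hmm : Measurable m) {δ K A : ℝ} (hδ : 0 ≤ δ) (hK : 0 ≤ K) (hA : 0 ≤ A)
    (hsymb : (∀ ξ, (2 * Real.pi * ‖ξ‖) ^ 2 ≤ δ * (K * m ξ + A * m ξ ^ 2)) ∨ q =ᵐ[cyl d T] 0)
    (hdiss : ∀ᵐ p ∂(cyl d T), -2 * (w p * z p) + δ * ‖q p‖ ^ 2 + A * z p ^ 2 ≤ 0) :
    z =ᵐ[cyl d T] 0 := by
  have hl : 0 ≤ 2 + K := by positivity
  have hmain := fun {ε : ℝ} (hε : 0 < ε) => integral_regularized_energy_le hT hz hw hq hz2 hw2 hq2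
    hid hm hmm hδ hK hA hsymb hdiss hε
  set W := ∫ p, Real.exp (-(2 + K) * p.1) * w p ^ 2 ∂(cyl d T) with hW
  have hW0 : 0 ≤ W := integral_nonneg fun p => by positivity
  set J := ∫ p, Real.exp (-(2 + K) * p.1) * (‖spatialFourier z p‖ ^ 2 / (1 + m p.2)) ∂(cyl d T)
    with hJ
  have hJi := integrable_exp_mul_cyl hl (hmain one_pos).1
  have hnn : ∀ p : ℝ × E d,
      0 ≤ Real.exp (-(2 + K) * p.1) * (‖spatialFourier z p‖ ^ 2 / (1 + m p.2)) := fun p => by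
    have := hm p.2
    positivity
  -- The weight 1/(1 + m) is at most 1/(ε + m), so one energy, independent of ε, is bounded by εW
  -- for all small ε.
  have hJle : ∀ ε : ℝ, 0 < ε → ε ≤ 1 → J ≤ ε * W := fun ε hε hε1 => by
    refine le_trans (integral_mono hJi (integrable_exp_mul_cyl hl (hmain hε).1) fun p => ?_)
      (hmain hε).2
    have := hm p.2
    simp only
    gcongr
  have hJ0 : J = 0 := by
    refine le_antisymm ?_ (integral_nonneg hnn)
    by_contra! hpos
    have h1 := hJle (min 1 (J / (2 * (W + 1)))) (by positivity) (min_le_left _ _)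
    have h2 : min 1 (J / (2 * (W + 1))) * W ≤ J / (2 * (W + 1)) * (W + 1) := by
      gcongr
      · exact min_le_right _ _
      · linarith
    have h3 : J / (2 * (W + 1)) * (W + 1) = J / 2 := by field_simp
    linarith
  have hF : ∀ᵐ p ∂(cyl d T), ‖spatialFourier z p‖ ^ 2 = 0 := by
    filter_upwards [(integral_eq_zero_iff_of_nonneg hnn hJi).1 hJ0] with p hp
    have h1 := hm p.2
    simp only [Pi.zero_apply, mul_eq_zero, Real.exp_ne_zero, false_or, div_eq_zero_iff] at hp
    exact hp.resolve_right (by positivity)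
  have h1 := integral_exp_mul_norm_sq_spatialFourier hl hz hz2
  rw [integral_eq_zero_of_ae (by filter_upwards [hF] with p hp; simp [hp])] at h1
  filter_upwards [(integral_eq_zero_iff_of_nonneg (fun p => by positivity)
    (integrable_exp_mul_cyl hl hz2)).1 h1.symm] with p hp
  simpa using hp

/-- A symbol growing faster than `√r` controls `r` with an arbitrarily small quadratic part. -/
theorem HasPowerLowerBound.exists_le {Ψ : ℝ → ℝ} (hΨ : HasPowerLowerBound Ψ) {η : ℝ}
    (hη : 0 < η) : ∃ K : ℝ, 0 ≤ K ∧ ∀ r, 0 ≤ r → r ≤ K * Ψ r + η * Ψ r ^ 2 := by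
  obtain ⟨s, hs1, hs2, C, hC, h⟩ := hΨ
  have hlim := tendsto_rpow_neg_atTop (show 0 < 2 * s - 1 by linarith)
  -- R is the threshold beyond which r ≤ ηC² r^{2s}, where the quadratic term suffices; this needs
  -- 2s > 1. Below R, r ≤ R^{1-s} r^s and the linear term suffices.
  obtain ⟨R, hR1, hR2⟩ :=
    (((tendsto_order.1 hlim).2 (η * C ^ 2) (by positivity)).and (eventually_gt_atTop 0)).exists
  refine ⟨R ^ (1 - s) / C, by positivity, fun r hr => ?_⟩
  have hΨr := h r hr
  have hrs : 0 ≤ r ^ s := Real.rpow_nonneg hr s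
  have hΨ0 : 0 ≤ Ψ r := le_trans (by positivity) hΨr
  rcases hr.eq_or_lt with rfl | hr0
  · positivity
  rcases le_total r R with hrR | hrR
  · have h1 : r = r ^ (1 - s) * r ^ s := by
      rw [← Real.rpow_add hr0]; simp
    have h2 : r ^ (1 - s) ≤ R ^ (1 - s) := Real.rpow_le_rpow hr hrR (by linarith)
    calc r = r ^ (1 - s) * r ^ s := h1
      _ ≤ R ^ (1 - s) * (Ψ r / C) := by
        gcongr
        rw [le_div_iff₀ hC, mul_comm]; exact hΨr
      _ = R ^ (1 - s) / C * Ψ r := by ring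
      _ ≤ _ := le_add_of_nonneg_right (by positivity)
  · have h1 : r = r ^ (-(2 * s - 1)) * (r ^ s) ^ 2 := by
      rw [← Real.rpow_natCast (r ^ s) 2, ← Real.rpow_mul hr, ← Real.rpow_add hr0]
      convert (Real.rpow_one r).symm using 2
      push_cast; ring
    have h2 : r ^ (-(2 * s - 1)) ≤ R ^ (-(2 * s - 1)) :=
      Real.rpow_le_rpow_of_nonpos hR2 hrR (by linarith)
    calc r = r ^ (-(2 * s - 1)) * (r ^ s) ^ 2 := h1
      _ ≤ (η * C ^ 2) * (r ^ s) ^ 2 := by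
        gcongr
        exact h2.trans hR1.le
      _ = η * (C * r ^ s) ^ 2 := by ring
      _ ≤ η * Ψ r ^ 2 := by gcongr
      _ ≤ _ := le_add_of_nonneg_left (by positivity)

theorem exists_abs_sub_le_of_contDiff {g : ℝ → ℝ} (hg : ContDiff ℝ 1 g) (M : ℝ) :
    ∃ L : ℝ, 0 ≤ L ∧ ∀ r ∈ Icc (-M) M, ∀ r' ∈ Icc (-M) M, |g r - g r'| ≤ L * |r - r'| := by
  obtain ⟨L, hL⟩ := (isCompact_Icc (a := -M) (b := M)).exists_bound_of_continuousOn
    (hg.continuous_deriv le_rfl).continuousOn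
  refine ⟨max L 0, le_max_right _ _, fun r hr r' hr' => ?_⟩
  exact (convex_Icc (-M) M).norm_image_sub_le_of_norm_deriv_le
    (fun x _ => hg.differentiable one_ne_zero x) (fun x hx => (hL x hx).trans (le_max_left _ _))
    hr' hr

theorem mul_sq_sub_le_of_le_deriv {g : ℝ → ℝ} (hg : ContDiff ℝ 1 g) {M α : ℝ}
    (hα : ∀ r ∈ Icc (-M) M, α ≤ deriv g r) {r r' : ℝ} (hr : r ∈ Icc (-M) M)
    (hr' : r' ∈ Icc (-M) M) : α * (r - r') ^ 2 ≤ (g r - g r') * (r - r') := by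
  have key : ∀ x ∈ Icc (-M) M, ∀ y ∈ Icc (-M) M, x ≤ y → α * (y - x) ≤ g y - g x :=
    (convex_Icc (-M) M).mul_sub_le_image_sub_of_le_deriv hg.continuous.continuousOn
      (hg.differentiable one_ne_zero).differentiableOn
      fun x hx => hα x (interior_subset hx)
  rcases le_total r r' with h | h
  · nlinarith [key r hr r' hr' h]
  · nlinarith [key r' hr' r hr h]

/-- The symbol of the Lévy operator with jump measure `ν`. -/
noncomputable def levySymbol (ν : Measure (E d)) (ξ : E d) : ℝ :=
  ∫ v, (1 - Real.cos (2 * Real.pi * inner ℝ v ξ)) ∂ν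

theorem levySymbol_nonneg (ν : Measure (E d)) (ξ : E d) : 0 ≤ levySymbol ν ξ :=
  integral_nonneg fun _ => sub_nonneg.2 (Real.cos_le_one _)

theorem measurable_levySymbol (ν : Measure (E d)) [SFinite ν] : Measurable (levySymbol ν) := by
  have h : StronglyMeasurable (fun r : E d × E d =>
      1 - Real.cos (2 * Real.pi * inner ℝ r.2 r.1)) :=
    Continuous.stronglyMeasurable (by fun_prop)
  exact h.integral_prod_right'.measurable

/-- Uniqueness for the linear problem, when `w` and `q` are controlled by `z` and `w` is a
monotone function of `z`. -/
theorem ae_eq_zero_of_monotone (hT : 0 < T) {Ψ : ℝ → ℝ} (hΨs : HasPowerLowerBound Ψ)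
    {ν : Measure (E d)} [SFinite ν]
    (hΨν : ∀ ξ : E d, Ψ ((2 * Real.pi * ‖ξ‖) ^ 2) = levySymbol ν ξ) {M L L' : ℝ}
    (hz : Integrable z (cyl d T)) (hwm : AEStronglyMeasurable w (cyl d T))
    (hqm : AEStronglyMeasurable q (cyl d T)) (hzM : ∀ᵐ p ∂(cyl d T), |z p| ≤ M)
    (hwL : ∀ᵐ p ∂(cyl d T), |w p| ≤ L * |z p|) (hqL : ∀ᵐ p ∂(cyl d T), ‖q p‖ ≤ L' * |z p|)
    (hmono : (∃ α : ℝ, 0 < α ∧ ∀ᵐ p ∂(cyl d T), α * z p ^ 2 ≤ w p * z p) ∨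
      (q =ᵐ[cyl d T] 0 ∧ ∀ᵐ p ∂(cyl d T), 0 ≤ w p * z p))
    (hid : ∀ (ξ : E d) (a : ℝ), ∀ᵐ t ∂volume.restrict (Ioo 0 T),
      ∫ x, z (t, x) * planeWave ξ a x =
      ∫ p, (-(w p * (planeWave ξ a p.2 * levySymbol ν ξ)) +
        fderiv ℝ (planeWave ξ a) p.2 (q p)) ∂(cyl d t)) :
    z =ᵐ[cyl d T] 0 := by
  have hwi : Integrable w (cyl d T) := (hz.norm.const_mul L).mono' hwm hwL
  have hqi : Integrable q (cyl d T) := (hz.norm.const_mul L').mono' hqm hqL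
  have hz2 : Integrable (fun p => z p ^ 2) (cyl d T) := by
    refine (hz.norm.const_mul M).mono' (hz.1.pow 2) ?_
    filter_upwards [hzM] with p hp
    rw [Real.norm_of_nonneg (sq_nonneg _), ← sq_abs, sq, Real.norm_eq_abs]
    exact mul_le_mul_of_nonneg_right hp (abs_nonneg _)
  have hw2 : Integrable (fun p => w p ^ 2) (cyl d T) := by
    refine (hz2.const_mul (L ^ 2)).mono' (hwm.pow 2) ?_
    filter_upwards [hwL] with p hp
    rw [Real.norm_of_nonneg (sq_nonneg _), ← sq_abs, ← sq_abs (z p), ← mul_pow]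
    exact pow_le_pow_left₀ (abs_nonneg _) hp 2
  have hq2' : ∀ᵐ p ∂(cyl d T), ‖q p‖ ^ 2 ≤ L' ^ 2 * z p ^ 2 := by
    filter_upwards [hqL] with p hp
    rw [← sq_abs (z p), ← mul_pow]
    exact pow_le_pow_left₀ (norm_nonneg _) hp 2
  have hq2 : Integrable (fun p => ‖q p‖ ^ 2) (cyl d T) := by
    refine (hz2.const_mul (L' ^ 2)).mono' (hqm.norm.pow 2) ?_
    filter_upwards [hq2'] with p hp
    rwa [Real.norm_of_nonneg (sq_nonneg _)]
  have hcore := fun {δ K A : ℝ} => ae_eq_zero_of_energy_le (δ := δ) (K := K) (A := A) hT hz hwi hqi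
    hz2 hw2 hq2 hid (levySymbol_nonneg ν) (measurable_levySymbol ν)
  rcases hmono with ⟨α, hα, hαle⟩ | ⟨hq0, hwz⟩
  -- With δ = A = κ one has δ|q|² + Az² ≤ κ(L'² + 1)z² = αz² ≤ wz. The quadratic coefficient in the
  -- symbol bound is then δA = κ², hence the η below; the factor κ⁻¹ in K compensates δ.
  · obtain ⟨κ, hκ0, hκ⟩ : ∃ κ : ℝ, 0 < κ ∧ κ * (1 + L' ^ 2) = α :=
      ⟨α / (1 + L' ^ 2), by positivity, by field_simp⟩
    obtain ⟨K, hK0, hK⟩ := hΨs.exists_le (η := κ * κ) (by positivity)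
    refine hcore (δ := κ) (K := κ⁻¹ * K) (A := κ) hκ0.le (by positivity) hκ0.le
      (Or.inl fun ξ => ?_) ?_
    · refine (hK _ (by positivity)).trans_eq ?_
      rw [hΨν ξ]
      field_simp
    · filter_upwards [hαle, hq2'] with p h1 h2
      have h3 := mul_le_mul_of_nonneg_left h2 hκ0.le
      have h4 : κ * (L' ^ 2 * z p ^ 2) + κ * z p ^ 2 = α * z p ^ 2 := by rw [← hκ]; ring
      have h5 : 0 ≤ α * z p ^ 2 := by positivity
      linarith
  -- Without flux there is nothing to absorb: δ = K = A = 0, and monotonicity alone gives the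
  -- dissipation inequality.
  · refine hcore le_rfl le_rfl le_rfl (Or.inr hq0) ?_
    filter_upwards [hwz] with p hp
    linarith

end Uniqueness

/-- Uniqueness of essentially bounded distributional solutions. -/
theorem ae_eq_of_isDistributionalSolution {d : ℕ} {T : ℝ} (hT : 0 < T) {Ψ β b : ℝ → ℝ}
    {D : E d → E d}
    (hΨ : IsPureJumpBernstein Ψ) (hΨs : HasPowerLowerBound Ψ) (hβ : ContDiff ℝ 1 β)
    (hD : MemLp D ⊤ volume) (hb : ContDiff ℝ 1 b)
    (hβD : (∀ r : ℝ, 0 < deriv β r) ∨ ((∀ r : ℝ, 0 ≤ deriv β r) ∧ D =ᵐ[volume] 0))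
    {y₁ y₂ : ℝ × E d → ℝ} (hy₁ : MemLp y₁ ⊤ (cyl d T)) (hy₂ : MemLp y₂ ⊤ (cyl d T))
    (hsol₁ : IsDistributionalSolution T Ψ β b D y₁)
    (hsol₂ : IsDistributionalSolution T Ψ β b D y₂)
    (hz : Integrable (y₁ - y₂) (cyl d T)) (hz₀ : VanishesWeaklyAtZero (y₁ - y₂)) :
    y₁ =ᵐ[cyl d T] y₂ := by
  obtain ⟨ν, hνs, hν, hΨν⟩ := hΨ.exists_levyMeasure d
  obtain ⟨B, hB0, hDB⟩ : ∃ B, 0 ≤ B ∧ ∀ᵐ x, ‖D x‖ ≤ B :=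
    ⟨_, ENNReal.toReal_nonneg, ae_norm_le_of_memLp_top hD⟩
  have hB : ∀ᵐ p ∂(cyl d T), ‖D p.2‖ ≤ B := Measure.quasiMeasurePreserving_snd.ae hDB
  obtain ⟨M, hI₁, hI₂⟩ : ∃ M, (∀ᵐ p ∂(cyl d T), y₁ p ∈ Icc (-M) M) ∧
      ∀ᵐ p ∂(cyl d T), y₂ p ∈ Icc (-M) M := by
    refine ⟨max (eLpNormEssSup y₁ (cyl d T)).toReal (eLpNormEssSup y₂ (cyl d T)).toReal, ?_, ?_⟩
    · filter_upwards [ae_norm_le_of_memLp_top hy₁] with p hp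
      exact abs_le.1 (hp.trans (le_max_left _ _))
    · filter_upwards [ae_norm_le_of_memLp_top hy₂] with p hp
      exact abs_le.1 (hp.trans (le_max_right _ _))
  have hbb : ContDiff ℝ 1 (fun r => b r * r) := hb.mul contDiff_id
  obtain ⟨L, hL0, hL⟩ := exists_abs_sub_le_of_contDiff hβ M
  obtain ⟨L', hL'0, hL'⟩ := exists_abs_sub_le_of_contDiff hbb M
  have hzM : ∀ᵐ p ∂(cyl d T), |(y₁ - y₂) p| ≤ 2 * M := by
    filter_upwards [hI₁, hI₂] with p h1 h2
    rw [Pi.sub_apply, abs_le]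
    constructor <;> linarith [h1.1, h1.2, h2.1, h2.2]
  have hwL : ∀ᵐ p ∂(cyl d T), |β (y₁ p) - β (y₂ p)| ≤ L * |(y₁ - y₂) p| := by
    filter_upwards [hI₁, hI₂] with p h1 h2 using hL _ h1 _ h2
  have hqL : ∀ᵐ p ∂(cyl d T), ‖(b (y₁ p) * y₁ p - b (y₂ p) * y₂ p) • D p.2‖ ≤
      L' * B * |(y₁ - y₂) p| := by
    filter_upwards [hI₁, hI₂, hB] with p h1 h2 h3
    rw [norm_smul, mul_right_comm]
    exact mul_le_mul (hL' _ h1 _ h2) h3 (norm_nonneg _) (by positivity)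
  have hwm : AEStronglyMeasurable (fun p => β (y₁ p) - β (y₂ p)) (cyl d T) :=
    (hβ.continuous.comp_aestronglyMeasurable hy₁.1).sub
      (hβ.continuous.comp_aestronglyMeasurable hy₂.1)
  have hqm : AEStronglyMeasurable
      (fun p : ℝ × E d => (b (y₁ p) * y₁ p - b (y₂ p) * y₂ p) • D p.2) (cyl d T) :=
    ((hbb.continuous.comp_aestronglyMeasurable hy₁.1).sub
      (hbb.continuous.comp_aestronglyMeasurable hy₂.1)).smul hD.1.comp_snd
  have hpsi : ∀ f : E d → ℝ, ContDiff ℝ ∞ f → HasCompactSupport f →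
      psiNegLaplacian Ψ f = fun x => ∫ v, secondDiff f x v ∂ν := fun f hf hfc =>
    funext (psiNegLaplacian_eq_integral_secondDiff hν hΨν hf hfc)
  have hmono : (∃ α : ℝ, 0 < α ∧ ∀ᵐ p ∂(cyl d T),
        α * (y₁ - y₂) p ^ 2 ≤ (β (y₁ p) - β (y₂ p)) * (y₁ - y₂) p) ∨
      ((fun p : ℝ × E d => (b (y₁ p) * y₁ p - b (y₂ p) * y₂ p) • D p.2) =ᵐ[cyl d T] 0 ∧
        ∀ᵐ p ∂(cyl d T), 0 ≤ (β (y₁ p) - β (y₂ p)) * (y₁ - y₂) p) := by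
    rcases hβD with hpos | ⟨hnn, hD0⟩
    -- Boundedness of the solutions matters here: on the compact range, pointwise positivity of the
    -- continuous β' becomes a uniform lower bound.
    · obtain ⟨α, hα, hαle⟩ : ∃ α : ℝ, 0 < α ∧ ∀ r ∈ Icc (-M) M, α ≤ deriv β r :=
        isCompact_Icc.exists_forall_le' (hβ.continuous_deriv le_rfl).continuousOn
          (fun r _ => hpos r)
      refine Or.inl ⟨α, hα, ?_⟩
      filter_upwards [hI₁, hI₂] with p h1 h2 using mul_sq_sub_le_of_le_deriv hβ hαle h1 h2
    · refine Or.inr ⟨?_, ?_⟩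
      · have h1 : ∀ᵐ p ∂(cyl d T), D p.2 = 0 :=
          Measure.quasiMeasurePreserving_snd.ae (p := fun x => D x = 0) hD0
        filter_upwards [h1] with p hp
        simp [hp]
      · filter_upwards [hI₁, hI₂] with p h1 h2
        have h3 := mul_sq_sub_le_of_le_deriv hβ (fun r _ => hnn r) h1 h2
        rwa [zero_mul] at h3
  have hid := ae_integral_mul_planeWave_eq hν hz ((hz.norm.const_mul L).mono' hwm hwL)
    ((hz.norm.const_mul (L' * B)).mono' hqm hqL) fun f hf hfc => by
      have h1 := ae_integral_mul_eq_of_isDistributionalSolution hT hβ.continuous hb.continuous hD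
        hy₁ hy₂ hsol₁ hsol₂ hz hz₀ hf hfc
        (by rw [hpsi f hf hfc]; exact integrable_integral_secondDiff hν hf hfc)
      rw [hpsi f hf hfc] at h1
      exact h1
  filter_upwards [ae_eq_zero_of_monotone hT hΨs hΨν hz hwm hqm hzM hwL hqL hmono hid] with p hp
  exact sub_eq_zero.1 hp

end NonlocalFPE

theorem theorem3p1 (d : ℕ) (hd : 2 ≤ d) (T : ℝ) (hT : 0 < T)
    (Ψ β b : ℝ → ℝ) (D : NonlocalFPE.E d → NonlocalFPE.E d)
    (hΨ : NonlocalFPE.IsPureJumpBernstein Ψ) (hΨs : NonlocalFPE.HasPowerLowerBound Ψ)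
    (hβ : ContDiff ℝ 1 β) (hβ0 : β 0 = 0)
    (hD : MemLp D ⊤ volume) (hb : ContDiff ℝ 1 b)
    (hβD : (∀ r : ℝ, 0 < deriv β r) ∨ ((∀ r : ℝ, 0 ≤ deriv β r) ∧ D =ᵐ[volume] 0))
    (y₁ y₂ : ℝ × NonlocalFPE.E d → ℝ)
    (hy₁ : MemLp y₁ ⊤ (NonlocalFPE.cyl d T)) (hy₂ : MemLp y₂ ⊤ (NonlocalFPE.cyl d T))
    (hsol₁ : NonlocalFPE.IsDistributionalSolution T Ψ β b D y₁)
    (hsol₂ : NonlocalFPE.IsDistributionalSolution T Ψ β b D y₂)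
    (hz₁ : MemLp (y₁ - y₂) 1 (NonlocalFPE.cyl d T))
    (hz₂ : NonlocalFPE.MemLInftyL2 T (y₁ - y₂))
    (hz₀ : NonlocalFPE.VanishesWeaklyAtZero (y₁ - y₂)) :
    y₁ =ᵐ[NonlocalFPE.cyl d T] y₂ :=
  NonlocalFPE.ae_eq_of_isDistributionalSolution hT hΨ hΨs hβ hD hb hβD hy₁ hy₂ hsol₁ hsol₂
    (memLp_one_iff_integrable.1 hz₁) hz₀
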